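/- Let $M=2^{16}$. There is an absolute constant $D_2>0$ such that the following holds for every $3/2<\alpha<2$. Setting. Let $\Lambda$ be a square domain with free or periodic boundary conditions: the graph on the vertex set $\{0,\dots,L-1\}^2$, $L>1$ ($L$ even in the periodic case), in which two vertices are adjacent if they agree in one coordinate and differ by exactly one (periodic case: exactly one modulo $L$) in the other. Let $\operatorname{dist}$ be the graph distance of $\Lambda$. For each $j\in\Lambda$ let $\lambda_j(\phi)=1+2\sum_{q=1}^{N_j}\hat\lambda_j(q)\cos(q\phi)$ with an integer $N_j>0$ and real $\hat\lambda_j(q)$, and put $\hat\lambda_j(q)=0$ for $q>N_j$. A density is a function $\varrho:\Lambda\to\mathbb Z$, not identically zero; it is neutral if $\sum_j\varrho(j)=0$. Write $\operatorname{supp}\varrho=\{j:\varrho(j)\ne0\}$, $d(\varrho)=\max_{i,j\in\operatorname{supp}\varrho}\operatorname{dist}(i,j)$, $\operatorname{dist}(\varrho_1,\varrho_2)=\min_{i\in\operatorname{supp}\varrho_1,\,j\in\operatorname{supp}\varrho_2}\operatorname{dist}(i,j)$, and $\langle\psi,\varrho\rangle=\sum_j\psi(j)\varrho(j)$. An ensemble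 is a finite, possibly empty, set of densities with mutually disjoint supports. A $2^k\times2^k$ square ($k\ge0$) is a product of two intervals (periodic case: cyclic intervals) of $2^k$ consecutive elements of $\{0,\dots,L-1\}$ if $2^k\le L$, and is all of $\Lambda$ if $2^k>L$. Let $|\mathscr S_k(\varrho)|$ be the minimal number of $2^k\times 2^k$ squares needed to cover $\operatorname{supp}\varrho$. Put $A(\varrho)=\sum_{k=0}^{n(\varrho)}|\mathscr S_k(\varrho)|$ with $n(\varrho)=\lceil\log_2(M\,d(\varrho)^\alpha)\rceil$ if $d(\varrho)\ge1$, and $A(\varrho)=0$ if $d(\varrho)=0$. Claim. There exist a finite collection $\mathscr F$ of ensembles, positive numbers $c_{\mathscr N}$, $\mathscr N\in\mathscr F$, summing to $1$, and real numbers $K(\varrho)$, $\varrho\in\mathscr N\in\mathscr F$, such that for every $\psi:\Lambda\to\mathbb R$ $$\prod_{j\in\Lambda}\lambda_j(\psi(j))=\sum_{\mathscr N\in\mathscr F}c_{\mathscr N}\prod_{\varrho\in\mathscr N}\bigl[1+K(\varrho)\cos\langle\psi,\varrho\rangle\bigr],$$ and such that each $\mathscr N\in\mathscr F$ satisfies: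 (a) $\mathscr N$ contains at most one non-neutral density. (b) Distinct $\varrho_1,\varrho_2\in\mathscr N$ satisfy $\operatorname{dist}(\varrho_1,\varrho_2)\ge M[\min(d(\varrho_1),d(\varrho_2))]^\alpha$. Moreover, if $\varrho_c\in\mathscr N$ is non-neutral, then $\operatorname{dist}(\varrho,\varrho_c)\ge M[d(\varrho)]^\alpha$ for all $\varrho\in\mathscr N$, $\varrho\neq\varrho_c$. (c) If $\varrho\in\mathscr N$ is neutral and $\varrho=\varrho_1+\varrho_2$ with densities $\varrho_1,\varrho_2$ of disjoint supports satisfying $\operatorname{dist}(\varrho_1,\varrho_2)\ge 2M[\min(d(\varrho_1),d(\varrho_2))]^\alpha$, then $\varrho_1$ and $\varrho_2$ are non-neutral. (d) For every neutral $\varrho\in\mathscr N$, $$|K(\varrho)|\le e^{D_2A(\varrho)}\prod_{j\in\operatorname{supp}\varrho}e^{\varrho(j)^2}\bigl|\hat\lambda_j(|\varrho(j)|)\bigr|.$$ -/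

import Mathlib

namespace BKT

/-- The two kinds of boundary conditions under consideration. -/
inductive BC
  | free
  | per

/-- The vertex set `{0, …, L-1}²`. -/
abbrev Site (L : ℕ) : Type := Fin L × Fin L

/-- The side lengths that are allowed: `L > 1`, and moreover `L` even for periodic b.c. -/
def BC.Admissible : BC → ℕ → Prop
  | .free, L => 1 < L
  | .per, L => 1 < L ∧ Even L

/-- The square domain of side length `L`. `SimpleGraph.fromRel` symmetrizes the relation, so two
vertices are adjacent iff they agree in one coordinate and differ by exactly one (periodic b.c.:
by exactly one modulo `L`) in the other. -/
def domain : BC → (L : ℕ) → SimpleGraph (Site L)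
  | .free, _ => SimpleGraph.fromRel fun p q =>
      (p.1 = q.1 ∧ (p.2 : ℕ) + 1 = q.2) ∨ (p.2 = q.2 ∧ (p.1 : ℕ) + 1 = q.1)
  | .per, L => SimpleGraph.fromRel fun p q =>
      (p.1 = q.1 ∧ (p.2 : ℕ) + 1 ≡ q.2 [MOD L]) ∨ (p.2 = q.2 ∧ (p.1 : ℕ) + 1 ≡ q.1 [MOD L])

/-- `lam` is a real, even, normalized trigonometric polynomial with coefficients `lamHat q`,
`q ≥ 1`, extended by `0` beyond the degree. The value `lamHat 0` plays no role. -/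
def IsTrigPoly (lam : ℝ → ℝ) (lamHat : ℕ → ℝ) : Prop :=
  ∃ N : ℕ, 0 < N ∧ (∀ q, N < q → lamHat q = 0) ∧
    ∀ φ : ℝ, lam φ = 1 + 2 * ∑ q ∈ Finset.Icc 1 N, lamHat q * Real.cos (q * φ)

/-- The support of a density. -/
def supp {L : ℕ} (ρ : Site L → ℤ) : Finset (Site L) :=
  Finset.univ.filter fun j => ρ j ≠ 0

/-- The charge of a density. -/
def charge {L : ℕ} (ρ : Site L → ℤ) : ℤ := ∑ j, ρ j

/-- A density is neutral if its charge vanishes. -/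
def Neutral {L : ℕ} (ρ : Site L → ℤ) : Prop := charge ρ = 0

/-- An ensemble: a finite, possibly empty, collection of densities (integer-valued functions that
are not identically zero) whose supports are mutually disjoint. -/
def IsEnsemble {L : ℕ} (E : Finset (Site L → ℤ)) : Prop :=
  (∀ ρ ∈ E, ρ ≠ 0) ∧ ∀ ρ₁ ∈ E, ∀ ρ₂ ∈ E, ρ₁ ≠ ρ₂ → Disjoint (supp ρ₁) (supp ρ₂)

/-- The pairing `⟨ψ, ρ⟩`. -/
def pairing {L : ℕ} (ψ : Site L → ℝ) (ρ : Site L → ℤ) : ℝ := ∑ j, ψ j * (ρ j : ℝ)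

/-- The diameter `d(ρ)` of a density, in the graph distance. -/
noncomputable def diam (bc : BC) {L : ℕ} (ρ : Site L → ℤ) : ℕ :=
  (supp ρ).sup fun i => (supp ρ).sup fun j => (domain bc L).dist i j

/-- The distance between the supports of two densities, in the graph distance. -/
noncomputable def distance (bc : BC) {L : ℕ} (ρ₁ ρ₂ : Site L → ℤ) : ℕ :=
  sInf {n | ∃ i ∈ supp ρ₁, ∃ j ∈ supp ρ₂, n = (domain bc L).dist i j}

/-- The constant `M = 2 ^ 16`. -/
def M : ℝ := 2 ^ 16

/-- The coordinate `c` lies in the interval of `n` consecutive coordinates starting at `a`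
(periodic b.c.: cyclically). -/
def InInterval : BC → {L : ℕ} → ℕ → Fin L → Fin L → Prop
  | .free, _, n, a, c => (a : ℕ) ≤ c ∧ (c : ℕ) < a + n
  | .per, L, n, a, c => ((c : ℤ) - (a : ℤ)) % (L : ℤ) < n

/-- `s` is a `2^k × 2^k` square. Squares with `2^k ≤ L` are full, i.e. have `2^k * 2^k` points; for
`2^k > L` the only square is the whole domain. -/
def IsDyadicSquare (bc : BC) {L : ℕ} (k : ℕ) (s : Finset (Site L)) : Prop :=
  (∃ a b : Fin L, ∀ p : Site L,
      p ∈ s ↔ InInterval bc (2 ^ k) a p.1 ∧ InInterval bc (2 ^ k) b p.2) ∧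
    (2 ^ k ≤ L → s.card = 2 ^ k * 2 ^ k) ∧ (L < 2 ^ k → s = Finset.univ)

/-- The minimal number of `2^k × 2^k` squares in a cover of the support of `ρ`. -/
noncomputable def coverNumber (bc : BC) {L : ℕ} (k : ℕ) (ρ : Site L → ℤ) : ℕ :=
  sInf {n | ∃ C : Finset (Finset (Site L)),
    (∀ s ∈ C, IsDyadicSquare bc k s) ∧ supp ρ ⊆ C.biUnion id ∧ C.card = n}

/-- `n(ρ) = ⌈log₂ (M d(ρ)^α)⌉`, used only for `d(ρ) ≥ 1`, where the logarithm is positive. -/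
noncomputable def scale (bc : BC) (α : ℝ) {L : ℕ} (ρ : Site L → ℤ) : ℕ :=
  ⌈Real.logb 2 (M * (diam bc ρ : ℝ) ^ α)⌉₊

/-- `A(ρ)`: the sum of the cover numbers over the scales `0, …, n(ρ)` if `d(ρ) ≥ 1`, and `0` if
`d(ρ) = 0`. -/
noncomputable def coverSum (bc : BC) (α : ℝ) {L : ℕ} (ρ : Site L → ℤ) : ℕ :=
  if diam bc ρ = 0 then 0
  else ∑ k ∈ Finset.range (scale bc α ρ + 1), coverNumber bc k ρ

end BKT

/-!
Weighting the charge `q` by `2 exp (-q²)` writes each `λ_j` as a convex combination of factors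
`1 + z cos (q φ)`, so the product is a convex combination of products of factors of single-site
densities. Two densities that are too close to each other are removed by the convex identity

  `(1 + A cos a) (1 + B cos b) = 1/3 (1 + 3 A cos a) + 1/3 (1 + 3 B cos b)`
    `+ 1/6 (1 + 3 A B cos (a + b)) + 1/6 (1 + 3 A B cos (a - b))`,

applied at the distances `1, 2, 3, …` in turn, where a pair at distance `m` is treated only if `m`
is less than `M d(ρ)^α` for each of its neutral members `ρ`. A density assembled from parts at
distances at most `m` cannot then be split off later, which yields (a), (b) and (c).

For (d) the factors `3` are counted. While distances in `[2^k, 2^(k+1))` are treated, every factor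
`3` is charged to a separate site, and these sites are `2^k`-separated and near the support. Hence
a scale contributes at most `100` times the number of `2^k × 2^k` squares covering the support, and
the cover numbers of the smaller scales are superadditive under merging. As a factor with a smaller
coefficient is a convex combination of `1` and one with a larger coefficient, `K(ρ)` can finally be
raised to this bound, which depends on `ρ` alone.
-/

namespace BKT

open Finset

section Geometry

variable {bc : BC} {L : ℕ}

/-- The coordinates of the sites of a domain are integers modulo `bc.modulus L`. For free boundary
conditions the modulus is `0`, congruence modulo `0` being equality. -/
def BC.modulus : BC → ℕ → ℕ
  | .free, _ => 0
  | .per, L => L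

lemma BC.eq_of_modEq {a b : Fin L} (h : (a : ℤ) ≡ b [ZMOD bc.modulus L]) : a = b := by
  ext
  cases bc with
  | free => simpa [modulus, Int.modEq_zero_iff] using h
  | per => exact Nat.ModEq.eq_of_lt_of_lt (Int.natCast_modEq_iff.1 h) a.isLt b.isLt

lemma domain_adj {p q : Site L} : (domain bc L).Adj p q ↔ p ≠ q ∧
    ((p.1 = q.1 ∧ (q.2 : ℤ) ≡ p.2 + 1 [ZMOD bc.modulus L] ∨
        p.2 = q.2 ∧ (q.1 : ℤ) ≡ p.1 + 1 [ZMOD bc.modulus L]) ∨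
      (q.1 = p.1 ∧ (p.2 : ℤ) ≡ q.2 + 1 [ZMOD bc.modulus L] ∨
        q.2 = p.2 ∧ (p.1 : ℤ) ≡ q.1 + 1 [ZMOD bc.modulus L])) := by
  have hcast (a b : Fin L) : ((b : ℤ) ≡ a + 1 [ZMOD bc.modulus L]) ↔
      (a : ℕ) + 1 ≡ b [MOD bc.modulus L] := by
    rw [← Int.natCast_modEq_iff, Int.modEq_comm]
    push_cast
    rfl
  simp only [hcast]
  cases bc <;> simp [domain, BC.modulus, Nat.modEq_zero_iff]

lemma BC.exists_modEq_succ {a b : Fin L} {u : ℕ}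
    (h : (b : ℤ) ≡ a + (u + 1 : ℕ) [ZMOD bc.modulus L]) :
    ∃ x : Fin L, (x : ℤ) ≡ a + 1 [ZMOD bc.modulus L] := by
  cases bc with
  | free =>
    have hb : (b : ℤ) = a + (u + 1 : ℕ) := by simpa [modulus, Int.modEq_zero_iff] using h
    exact ⟨⟨a + 1, by omega⟩, by simp⟩
  | per => exact ⟨⟨(a + 1) % L, Nat.mod_lt _ a.pos⟩, by simpa [modulus] using Int.mod_modEq _ _⟩

lemma edist_le_natAbs_of_modEq {V : Type*} {G : SimpleGraph V} {f : Fin L → V}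
    (hf : ∀ a b : Fin L, (b : ℤ) ≡ a + 1 [ZMOD bc.modulus L] → G.edist (f a) (f b) ≤ 1)
    {a b : Fin L} {u : ℤ} (h : (b : ℤ) ≡ a + u [ZMOD bc.modulus L]) :
    G.edist (f a) (f b) ≤ u.natAbs := by
  have hnat (n : ℕ) : ∀ a b : Fin L, (b : ℤ) ≡ a + n [ZMOD bc.modulus L] →
      G.edist (f a) (f b) ≤ n := by
    induction n with
    | zero =>
      intro a b h
      obtain rfl : b = a := BC.eq_of_modEq (bc := bc) (by simpa using h)
      simp
    | succ n ih =>
      intro a b h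
      obtain ⟨x, hx⟩ := BC.exists_modEq_succ h
      have hxb : (b : ℤ) ≡ x + n [ZMOD bc.modulus L] := by
        refine h.trans ?_
        rw [show (a : ℤ) + (n + 1 : ℕ) = a + 1 + n by push_cast; ring]
        exact hx.symm.add_right _
      calc G.edist (f a) (f b) ≤ G.edist (f a) (f x) + G.edist (f x) (f b) := G.edist_triangle
        _ ≤ 1 + n := add_le_add (hf a x hx) (ih x b hxb)
        _ = (n + 1 : ℕ) := by rw [add_comm]; rfl
  obtain hu | hu := Int.natAbs_eq u
  · rw [hu] at h
    exact hnat _ a b h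
  · rw [SimpleGraph.edist_comm]
    refine hnat _ b a ?_
    have := h.symm.add_right (u.natAbs : ℤ)
    rwa [show (a : ℤ) + u + u.natAbs = a by omega] at this

/-- The point `x` of the square lattice `ℤ²` projects to the site `p`. -/
def IsLift (bc : BC) (p : Site L) (x : ℤ × ℤ) : Prop :=
  x.1 ≡ p.1 [ZMOD bc.modulus L] ∧ x.2 ≡ p.2 [ZMOD bc.modulus L]

lemma isLift_self (p : Site L) : IsLift bc p (p.1, p.2) := ⟨rfl, rfl⟩

lemma IsLift.edist_le {p q : Site L} {x y : ℤ × ℤ} (hp : IsLift bc p x) (hq : IsLift bc q y) :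
    (domain bc L).edist p q ≤ ((y.1 - x.1).natAbs + (y.2 - x.2).natAbs : ℕ) := by
  have hdiff {a b s t : ℤ} (ha : s ≡ a [ZMOD bc.modulus L]) (hb : t ≡ b [ZMOD bc.modulus L]) :
      b ≡ a + (t - s) [ZMOD bc.modulus L] := by
    have := ha.symm.add_right (t - s)
    rw [add_sub_cancel] at this
    exact (this.trans hb).symm
  have hfst : (domain bc L).edist (p.1, p.2) (q.1, p.2) ≤ (y.1 - x.1).natAbs :=
    edist_le_natAbs_of_modEq (f := fun a => (a, p.2)) (fun a b hab =>
      SimpleGraph.edist_le_one_iff_adj_or_eq.2 <| or_iff_not_imp_right.2 fun hne =>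
        domain_adj.2 ⟨hne, .inl (.inr ⟨rfl, hab⟩)⟩) (hdiff hp.1 hq.1)
  have hsnd : (domain bc L).edist (q.1, p.2) (q.1, q.2) ≤ (y.2 - x.2).natAbs :=
    edist_le_natAbs_of_modEq (f := fun b => (q.1, b)) (fun a b hab =>
      SimpleGraph.edist_le_one_iff_adj_or_eq.2 <| or_iff_not_imp_right.2 fun hne =>
        domain_adj.2 ⟨hne, .inl (.inl ⟨rfl, hab⟩)⟩) (hdiff hp.2 hq.2)
  push_cast
  exact ((domain bc L).edist_triangle).trans (add_le_add hfst hsnd)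

lemma domain_preconnected (bc : BC) (L : ℕ) : (domain bc L).Preconnected := fun p q =>
  SimpleGraph.reachable_of_edist_ne_top
    (((isLift_self p).edist_le (isLift_self q)).trans_lt (ENat.natCast_lt_top _)).ne

lemma IsLift.dist_le {p q : Site L} {x y : ℤ × ℤ} (hp : IsLift bc p x) (hq : IsLift bc q y) :
    (domain bc L).dist p q ≤ (y.1 - x.1).natAbs + (y.2 - x.2).natAbs := by
  have := hp.edist_le hq
  rwa [← (domain_preconnected bc L p q).coe_dist_eq_edist, Nat.cast_le] at this

lemma dist_lt_two_mul (bc : BC) (p q : Site L) : (domain bc L).dist p q < 2 * L := by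
  have := (isLift_self (bc := bc) p).dist_le (isLift_self q)
  simp only at this
  omega

lemma IsLift.exists_of_adj {p q : Site L} {x : ℤ × ℤ} (hp : IsLift bc p x)
    (h : (domain bc L).Adj p q) :
    ∃ y, IsLift bc q y ∧ (y.1 - x.1).natAbs + (y.2 - x.2).natAbs ≤ 1 := by
  have hpred {a b s : ℤ} (ha : s ≡ a [ZMOD bc.modulus L]) (hb : a ≡ b + 1 [ZMOD bc.modulus L]) :
      s - 1 ≡ b [ZMOD bc.modulus L] := by simpa using (ha.trans hb).sub_right 1
  rcases (domain_adj.1 h).2 with (⟨h₁, h₂⟩ | ⟨h₂, h₁⟩) | (⟨h₁, h₂⟩ | ⟨h₂, h₁⟩)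
  · exact ⟨(x.1, x.2 + 1), ⟨h₁ ▸ hp.1, (hp.2.add_right 1).trans h₂.symm⟩, by simp⟩
  · exact ⟨(x.1 + 1, x.2), ⟨(hp.1.add_right 1).trans h₁.symm, h₂ ▸ hp.2⟩, by simp⟩
  · exact ⟨(x.1, x.2 - 1), ⟨h₁ ▸ hp.1, hpred hp.2 h₂⟩, by simp⟩
  · exact ⟨(x.1 - 1, x.2), ⟨hpred hp.1 h₁, h₂ ▸ hp.2⟩, by simp⟩

lemma IsLift.exists_of_walk {p q : Site L} {x : ℤ × ℤ} (hp : IsLift bc p x)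
    (w : (domain bc L).Walk p q) :
    ∃ y, IsLift bc q y ∧ (y.1 - x.1).natAbs + (y.2 - x.2).natAbs ≤ w.length := by
  induction w generalizing x with
  | nil => exact ⟨x, hp, by simp⟩
  | cons hadj w ih =>
    obtain ⟨y, hy, hxy⟩ := hp.exists_of_adj hadj
    obtain ⟨z, hz, hyz⟩ := ih hy
    exact ⟨z, hz, by simp only [SimpleGraph.Walk.length_cons]; omega⟩

lemma IsLift.exists_le_dist {p : Site L} {x : ℤ × ℤ} (hp : IsLift bc p x) (q : Site L) :
    ∃ y, IsLift bc q y ∧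
      (y.1 - x.1).natAbs + (y.2 - x.2).natAbs ≤ (domain bc L).dist p q := by
  obtain ⟨w, hw⟩ := (domain_preconnected bc L p q).exists_walk_length_eq_dist
  exact hw ▸ hp.exists_of_walk w

lemma InInterval.exists_offset {n : ℕ} {a c : Fin L} (h : InInterval bc n a c) :
    ∃ u ∈ Ico (0 : ℤ) n, a + u ≡ c [ZMOD bc.modulus L] := by
  cases bc with
  | free =>
    have h : (a : ℕ) ≤ c ∧ (c : ℕ) < a + n := h
    exact ⟨c - a, by rw [mem_Ico]; omega, by simp⟩
  | per =>
    have hL : (0 : ℤ) < L := by exact_mod_cast a.pos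
    refine ⟨((c : ℤ) - a) % L, mem_Ico.2 ⟨Int.emod_nonneg _ hL.ne', h⟩, ?_⟩
    simpa [BC.modulus] using (Int.mod_modEq ((c : ℤ) - a) L).add_left a

lemma IsDyadicSquare.exists_corner {k : ℕ} {s : Finset (Site L)} (hs : IsDyadicSquare bc k s) :
    ∃ x : ℤ × ℤ, ∀ p ∈ s, ∃ y, IsLift bc p y ∧
      y.1 ∈ Ico x.1 (x.1 + 2 ^ k) ∧ y.2 ∈ Ico x.2 (x.2 + 2 ^ k) := by
  obtain ⟨⟨a, b, h⟩, -⟩ := hs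
  refine ⟨(a, b), fun p hp => ?_⟩
  obtain ⟨ha, hb⟩ := (h p).1 hp
  obtain ⟨u, hu, hpu⟩ := ha.exists_offset
  obtain ⟨v, hv, hpv⟩ := hb.exists_offset
  rw [Nat.cast_pow, Nat.cast_ofNat] at hu hv
  exact ⟨(a + u, b + v), ⟨hpu, hpv⟩, by simpa using hu, by simpa using hv⟩

lemma IsDyadicSquare.dist_lt {k : ℕ} {s : Finset (Site L)} (hs : IsDyadicSquare bc k s)
    {p q : Site L} (hp : p ∈ s) (hq : q ∈ s) : (domain bc L).dist p q < 2 ^ (k + 1) := by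
  obtain ⟨x, hx⟩ := hs.exists_corner
  obtain ⟨y, hy, hy₁, hy₂⟩ := hx p hp
  obtain ⟨z, hz, hz₁, hz₂⟩ := hx q hq
  have hyz := hy.dist_le hz
  have hpow : ((2 ^ k : ℕ) : ℤ) = 2 ^ k := by simp
  simp only [mem_Ico] at hy₁ hy₂ hz₁ hz₂
  rw [pow_succ]
  omega

open Classical in
lemma exists_inInterval_card (bc : BC) {n : ℕ} (hn : 0 < n) (hnL : n ≤ L) (x : Fin L) :
    ∃ a : Fin L, InInterval bc n a x ∧ #{c | InInterval bc n a c} = n := by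
  have : NeZero L := ⟨x.pos.ne'⟩
  cases bc with
  | free =>
    refine ⟨⟨min x (L - n), by omega⟩, by simp only [InInterval]; omega, ?_⟩
    have hIco : ({c | InInterval .free n ⟨min x (L - n), by omega⟩ c} : Finset (Fin L)).map
        Fin.valEmbedding = Ico (min (x : ℕ) (L - n)) (min (x : ℕ) (L - n) + n) := by
      ext c
      rw [mem_map, mem_Ico]
      exact ⟨by rintro ⟨c, h, rfl⟩; exact (mem_filter.1 h).2,
        fun h => ⟨⟨c, by omega⟩, mem_filter.2 ⟨mem_univ _, h⟩, rfl⟩⟩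
    rw [← card_map Fin.valEmbedding, hIco, Nat.card_Ico, Nat.add_sub_cancel_left]
  | per =>
    refine ⟨x, by simpa [InInterval] using hn, ?_⟩
    have hsub (c : Fin L) : InInterval .per n x c ↔ (c - x).val < n := by
      have hcast : (((c - x : Fin L) : ℕ) : ℤ) = ((c : ℤ) - x) % L := by
        rw [Fin.val_sub, Int.natCast_mod, Nat.cast_add, Nat.cast_sub x.isLt.le]
        exact (Int.modEq_iff_dvd.2 ⟨-1, by ring⟩)
      rw [InInterval, ← hcast, Nat.cast_lt]
    calc #{c | InInterval .per n x c} = #{c : Fin L | c.val < n} :=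
          card_equiv (Equiv.subRight x) fun c => by simp [hsub]
      _ = n := by rw [Fin.card_filter_val_lt, min_eq_right hnL]

lemma inInterval_zero [NeZero L] {n : ℕ} (hn : L < n) (c : Fin L) : InInterval bc n 0 c := by
  cases bc with
  | free => exact ⟨by simp, by simp; omega⟩
  | per =>
    change ((c : ℤ) - (0 : Fin L)) % L < n
    rw [Fin.val_zero, Nat.cast_zero, sub_zero, Int.emod_eq_of_lt (by omega) (by omega)]
    omega

lemma exists_isDyadicSquare_mem (bc : BC) (k : ℕ) (p : Site L) :
    ∃ s, IsDyadicSquare bc k s ∧ p ∈ s := by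
  classical
  have : NeZero L := ⟨p.1.pos.ne'⟩
  obtain hk | hk := le_or_gt (2 ^ k) L
  · obtain ⟨a, ha, hcarda⟩ := exists_inInterval_card bc (by positivity) hk p.1
    obtain ⟨b, hb, hcardb⟩ := exists_inInterval_card bc (by positivity) hk p.2
    refine ⟨univ.filter (InInterval bc (2 ^ k) a) ×ˢ univ.filter (InInterval bc (2 ^ k) b),
      ⟨⟨a, b, by simp⟩, fun _ => ?_, fun h => by omega⟩, by simp [ha, hb]⟩
    rw [card_product, hcarda, hcardb]
  · exact ⟨univ, ⟨⟨0, 0, by simp [inInterval_zero hk]⟩, fun h => by omega, fun _ => rfl⟩,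
      mem_univ p⟩

lemma exists_cover (bc : BC) (k : ℕ) (ρ : Site L → ℤ) :
    ∃ C : Finset (Finset (Site L)), (∀ s ∈ C, IsDyadicSquare bc k s) ∧
      supp ρ ⊆ C.biUnion id ∧ #C = coverNumber bc k ρ := by
  classical
  choose square hsquare hmem using exists_isDyadicSquare_mem bc (L := L) k
  refine Nat.sInf_mem (s := {n | ∃ C : Finset (Finset (Site L)),
    (∀ s ∈ C, IsDyadicSquare bc k s) ∧ supp ρ ⊆ C.biUnion id ∧ #C = n})
    ⟨_, (supp ρ).image square, fun s hs => ?_,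
      fun p hp => mem_biUnion.2 ⟨square p, mem_image_of_mem _ hp, hmem p⟩, rfl⟩
  obtain ⟨p, -, rfl⟩ := mem_image.1 hs
  exact hsquare p

lemma coverNumber_le {k : ℕ} {ρ : Site L → ℤ} {C : Finset (Finset (Site L))}
    (hC : ∀ s ∈ C, IsDyadicSquare bc k s) (h : supp ρ ⊆ C.biUnion id) :
    coverNumber bc k ρ ≤ #C :=
  Nat.sInf_le ⟨C, hC, h, rfl⟩

lemma two_mul_natAbs_sub_lt {n a b : ℤ} (hn : 0 < n) (h : 2 * a / n = 2 * b / n) :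
    2 * ((b - a).natAbs : ℤ) < n := by
  have ha := Int.mul_ediv_add_emod (2 * a) n
  have hb := Int.mul_ediv_add_emod (2 * b) n
  have := Int.emod_nonneg (2 * a) hn.ne'
  have := Int.emod_nonneg (2 * b) hn.ne'
  have := Int.emod_lt_of_pos (2 * a) hn
  have := Int.emod_lt_of_pos (2 * b) hn
  rw [h] at ha
  omega

/- A grid of boxes of side `2 ^ k / 2` puts at most one point of `T` in each box, and `10 * 10`
boxes suffice to cover the `2 ^ (k + 1)`-neighbourhood of the square. -/
lemma card_le_hundred_of_near_square {k : ℕ} {s T : Finset (Site L)} (hs : IsDyadicSquare bc k s)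
    (hsep : (T : Set (Site L)).Pairwise fun p q => 2 ^ k ≤ (domain bc L).dist p q)
    (hnear : ∀ t ∈ T, ∃ i ∈ s, (domain bc L).dist i t < 2 ^ (k + 1)) : #T ≤ 100 := by
  have hpos : (0 : ℤ) < 2 ^ k := by positivity
  have hpow : ((2 ^ k : ℕ) : ℤ) = 2 ^ k := by simp
  obtain ⟨x, hx⟩ := hs.exists_corner
  have hlift (t : Site L) (ht : t ∈ T) : ∃ y, IsLift bc t y ∧
      2 * (y.1 - x.1) / 2 ^ k ∈ Ico (-4 : ℤ) 6 ∧ 2 * (y.2 - x.2) / 2 ^ k ∈ Ico (-4 : ℤ) 6 := by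
    obtain ⟨i, hi, hit⟩ := hnear t ht
    obtain ⟨z, hz, hz₁, hz₂⟩ := hx i hi
    obtain ⟨y, hy, hzy⟩ := hz.exists_le_dist t
    have hlt := hzy.trans_lt hit
    rw [pow_succ] at hlt
    simp only [mem_Ico, Int.le_ediv_iff_mul_le hpos, Int.ediv_lt_iff_lt_mul hpos] at hz₁ hz₂ ⊢
    exact ⟨y, hy, by omega, by omega⟩
  choose! lift hlift hbox₁ hbox₂ using hlift
  let box (t : Site L) : ℤ × ℤ :=
    (2 * ((lift t).1 - x.1) / 2 ^ k, 2 * ((lift t).2 - x.2) / 2 ^ k)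
  have hinj : Set.InjOn box T := by
    intro p hp q hq hpq
    by_contra hne
    have hle := (hsep hp hq hne).trans ((hlift p hp).dist_le (hlift q hq))
    have h₁ := two_mul_natAbs_sub_lt hpos (congrArg Prod.fst hpq)
    have h₂ := two_mul_natAbs_sub_lt hpos (congrArg Prod.snd hpq)
    rw [sub_sub_sub_cancel_right] at h₁ h₂
    omega
  calc #T ≤ #(Ico (-4 : ℤ) 6 ×ˢ Ico (-4 : ℤ) 6) :=
        card_le_card_of_injOn box (fun t ht => mem_product.2 ⟨hbox₁ t ht, hbox₂ t ht⟩) hinj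
    _ = 100 := by simp

lemma card_le_hundred_mul_coverNumber {k : ℕ} {ρ : Site L → ℤ} {T : Finset (Site L)}
    (hsep : (T : Set (Site L)).Pairwise fun p q => 2 ^ k ≤ (domain bc L).dist p q)
    (hnear : ∀ t ∈ T, ∃ i ∈ supp ρ, (domain bc L).dist i t < 2 ^ (k + 1)) :
    #T ≤ 100 * coverNumber bc k ρ := by
  classical
  obtain ⟨C, hC, hcov, hcard⟩ := exists_cover bc k ρ
  let near (s : Finset (Site L)) := {t ∈ T | ∃ i ∈ s, (domain bc L).dist i t < 2 ^ (k + 1)}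
  have hT : T ⊆ C.biUnion near := by
    intro t ht
    obtain ⟨i, hi, hit⟩ := hnear t ht
    obtain ⟨s, hs, his⟩ := mem_biUnion.1 (hcov hi)
    exact mem_biUnion.2 ⟨s, hs, mem_filter.2 ⟨ht, i, his, hit⟩⟩
  calc #T ≤ #(C.biUnion near) := card_le_card hT
    _ ≤ #C * 100 := card_biUnion_le_card_mul _ _ _ fun s hs =>
        card_le_hundred_of_near_square (hC s hs)
          (hsep.mono (coe_subset.2 (filter_subset _ _))) fun t ht => (mem_filter.1 ht).2
    _ = 100 * coverNumber bc k ρ := by rw [hcard, mul_comm]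

end Geometry

section Densities

variable {bc : BC} {α : ℝ} {L m : ℕ} {ρ σ τ : Site L → ℤ} {S : Set (Site L)}

@[simp]
lemma mem_supp {j : Site L} : j ∈ supp ρ ↔ ρ j ≠ 0 := by
  simp [supp]

@[simp]
lemma supp_eq_empty : supp ρ = ∅ ↔ ρ = 0 := by
  simp [Finset.ext_iff, funext_iff]

lemma supp_nonempty : (supp ρ).Nonempty ↔ ρ ≠ 0 := by
  rw [nonempty_iff_ne_empty, Ne, supp_eq_empty]

@[simp]
lemma supp_neg (ρ : Site L → ℤ) : supp (-ρ) = supp ρ := by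
  ext
  simp

lemma supp_add (h : Disjoint (supp σ) (supp τ)) : supp (σ + τ) = supp σ ∪ supp τ := by
  ext j
  have : σ j ≠ 0 → ¬ τ j ≠ 0 := fun hσ hτ =>
    disjoint_left.1 h (mem_supp.2 hσ) (mem_supp.2 hτ)
  simp only [mem_supp, mem_union, Pi.add_apply]
  omega

lemma supp_indicator_subset : supp (S.indicator ρ) ⊆ supp ρ := fun j => by
  simp only [mem_supp]
  exact fun h h0 => h (by simp [h0])

@[simp]
lemma neutral_neg : Neutral (-ρ) ↔ Neutral ρ := by
  simp [Neutral, charge]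

lemma charge_add (σ τ : Site L → ℤ) : charge (σ + τ) = charge σ + charge τ := by
  simp [charge, sum_add_distrib]

@[simp]
lemma diam_neg (ρ : Site L → ℤ) : diam bc (-ρ) = diam bc ρ := by
  simp [diam]

@[simp]
lemma coverNumber_neg (k : ℕ) (ρ : Site L → ℤ) : coverNumber bc k (-ρ) = coverNumber bc k ρ := by
  simp [coverNumber]

lemma dist_le_diam {i j : Site L} (hi : i ∈ supp ρ) (hj : j ∈ supp ρ) :
    (domain bc L).dist i j ≤ diam bc ρ :=
  (le_sup (f := fun j => (domain bc L).dist i j) hj).trans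
    (le_sup (f := fun i => (supp ρ).sup fun j => (domain bc L).dist i j) hi)

lemma distance_le {i j : Site L} (hi : i ∈ supp σ) (hj : j ∈ supp τ) :
    distance bc σ τ ≤ (domain bc L).dist i j :=
  Nat.sInf_le ⟨i, hi, j, hj, rfl⟩

lemma exists_distance_eq (bc : BC) (hσ : σ ≠ 0) (hτ : τ ≠ 0) :
    ∃ i ∈ supp σ, ∃ j ∈ supp τ, distance bc σ τ = (domain bc L).dist i j := by
  obtain ⟨i, hi⟩ := supp_nonempty.2 hσ
  obtain ⟨j, hj⟩ := supp_nonempty.2 hτ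
  exact Nat.sInf_mem (s := {n | ∃ i ∈ supp σ, ∃ j ∈ supp τ, n = (domain bc L).dist i j})
    ⟨_, i, hi, j, hj, rfl⟩

lemma distance_comm (bc : BC) (σ τ : Site L → ℤ) : distance bc σ τ = distance bc τ σ := by
  simp only [distance]
  congr 1
  ext n
  exact ⟨fun ⟨i, hi, j, hj, h⟩ => ⟨j, hj, i, hi, h.trans SimpleGraph.dist_comm⟩,
    fun ⟨i, hi, j, hj, h⟩ => ⟨j, hj, i, hi, h.trans SimpleGraph.dist_comm⟩⟩

@[simp]
lemma distance_neg_right (σ τ : Site L → ℤ) : distance bc σ (-τ) = distance bc σ τ := by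
  simp [distance]

lemma distance_anti {σ' τ' : Site L → ℤ} (hσ : σ ≠ 0) (hτ : τ ≠ 0) (hσ' : supp σ ⊆ supp σ')
    (hτ' : supp τ ⊆ supp τ') : distance bc σ' τ' ≤ distance bc σ τ := by
  obtain ⟨i, hi, j, hj, h⟩ := exists_distance_eq bc hσ hτ
  exact h ▸ distance_le (hσ' hi) (hτ' hj)

lemma disjoint_supp_of_distance_pos (h : 0 < distance bc σ τ) : Disjoint (supp σ) (supp τ) :=
  disjoint_left.2 fun i hi hj => h.ne' (by simpa using distance_le (bc := bc) hi hj)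

lemma distance_le_diam_add (h : Disjoint (supp σ) (supp τ)) :
    distance bc σ τ ≤ diam bc (σ + τ) := by
  obtain h0 | hpos := Nat.eq_zero_or_pos (distance bc σ τ)
  · exact h0 ▸ Nat.zero_le _
  obtain ⟨_, i, hi, j, hj, -⟩ := Nat.nonempty_of_pos_sInf hpos
  exact (distance_le hi hj).trans <|
    dist_le_diam (by simp [supp_add h, mem_supp.1 hi]) (by simp [supp_add h, mem_supp.1 hj])

lemma distance_add_left (bc : BC) (hσ : σ ≠ 0) (hτ : τ ≠ 0)
    (h : Disjoint (supp σ) (supp τ)) (hρ : ρ ≠ 0) :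
    distance bc (σ + τ) ρ = min (distance bc σ ρ) (distance bc τ ρ) := by
  have hadd : σ + τ ≠ 0 := by
    rw [← supp_nonempty, supp_add h]
    exact (supp_nonempty.2 hσ).inl
  refine le_antisymm (le_min (distance_anti hσ hρ ?_ subset_rfl)
    (distance_anti hτ hρ ?_ subset_rfl)) ?_
  · simp [supp_add h]
  · simp [supp_add h]
  · obtain ⟨i, hi, j, hj, hij⟩ := exists_distance_eq bc hadd hρ
    rw [supp_add h, mem_union] at hi
    rw [hij]
    exact hi.elim (fun hi => min_le_of_left_le (distance_le hi hj))
      fun hi => min_le_of_right_le (distance_le hi hj)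

lemma coverNumber_add_le {k : ℕ} (h : 2 ^ (k + 1) ≤ distance bc σ τ) :
    coverNumber bc k σ + coverNumber bc k τ ≤ coverNumber bc k (σ + τ) := by
  classical
  have hdisj := disjoint_supp_of_distance_pos (Nat.two_pow_pos _ |>.trans_le h)
  obtain ⟨C, hC, hcov, hcard⟩ := exists_cover bc k (σ + τ)
  let meeting (ρ : Site L → ℤ) := {s ∈ C | ∃ i ∈ supp ρ, i ∈ s}
  have hmeeting {ρ : Site L → ℤ} (hρ : supp ρ ⊆ supp (σ + τ)) :
      coverNumber bc k ρ ≤ #(meeting ρ) := by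
    refine coverNumber_le (fun s hs => hC s (mem_filter.1 hs).1) fun p hp => ?_
    obtain ⟨s, hs, hps⟩ := mem_biUnion.1 (hcov (hρ hp))
    exact mem_biUnion.2 ⟨s, mem_filter.2 ⟨hs, p, hp, hps⟩, hps⟩
  have hmeeting_disj : Disjoint (meeting σ) (meeting τ) := by
    refine disjoint_left.2 fun s hs hs' => ?_
    obtain ⟨hsC, i, hi, his⟩ := mem_filter.1 hs
    obtain ⟨-, j, hj, hjs⟩ := mem_filter.1 hs'
    exact ((hC s hsC).dist_lt his hjs).not_ge (h.trans (distance_le hi hj))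
  calc coverNumber bc k σ + coverNumber bc k τ ≤ #(meeting σ) + #(meeting τ) :=
        add_le_add (hmeeting (by simp [supp_add hdisj])) (hmeeting (by simp [supp_add hdisj]))
    _ = #(meeting σ ∪ meeting τ) := (card_union_of_disjoint hmeeting_disj).symm
    _ ≤ #C := card_le_card (union_subset (filter_subset _ _) (filter_subset _ _))
    _ = coverNumber bc k (σ + τ) := hcard

lemma lt_M_mul_rpow (hα : 1 ≤ α) {d : ℕ} (hm : 0 < m) (hd : m ≤ d) :
    (m : ℝ) < M * (d : ℝ) ^ α := by
  have hm1 : (1 : ℝ) ≤ m := by exact_mod_cast hm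
  have hmd : (m : ℝ) ≤ d := by exact_mod_cast hd
  have hM : 1 < M := by norm_num [M]
  calc (m : ℝ) ≤ (d : ℝ) ^ α := hmd.trans (Real.self_le_rpow_of_one_le (hm1.trans hmd) hα)
    _ < M * (d : ℝ) ^ α :=
        lt_mul_of_one_lt_left (Real.rpow_pos_of_pos (by linarith) α) hM

/-- A density interacts with others at distance `r` if it is charged or `r < M d(ρ)^α`: pairs of
densities reaching each other have to be merged. -/
def Reaches (bc : BC) (α : ℝ) (ρ : Site L → ℤ) (r : ℕ) : Prop :=
  Neutral ρ → (r : ℝ) < M * (diam bc ρ : ℝ) ^ α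

lemma Reaches.mono {r s : ℕ} (h : Reaches bc α ρ s) (hrs : r ≤ s) : Reaches bc α ρ r :=
  fun hn => (Nat.cast_le.2 hrs).trans_lt (h hn)

@[simp]
lemma reaches_neg {r : ℕ} : Reaches bc α (-ρ) r ↔ Reaches bc α ρ r := by
  simp [Reaches]

lemma not_reaches_iff {r : ℕ} :
    ¬ Reaches bc α ρ r ↔ Neutral ρ ∧ M * (diam bc ρ : ℝ) ^ α ≤ (r : ℝ) := by
  rw [Reaches, Classical.not_imp, not_lt]

lemma reaches_of_le_diam (hα : 1 ≤ α) {r : ℕ} (hr : 0 < r) (h : r ≤ diam bc ρ) :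
    Reaches bc α ρ r :=
  fun _ => lt_M_mul_rpow hα hr h

/-- The set `S` splits `ρ` into two densities. -/
def Splits (S : Set (Site L)) (ρ : Site L → ℤ) : Prop :=
  S.indicator ρ ≠ 0 ∧ Sᶜ.indicator ρ ≠ 0

lemma splits_add (h : Splits S (σ + τ)) : Splits S σ ∨ Splits S τ ∨
    (S.indicator (σ + τ) = σ ∧ Sᶜ.indicator (σ + τ) = τ) ∨
      (S.indicator (σ + τ) = τ ∧ Sᶜ.indicator (σ + τ) = σ) := by
  have hσ := Set.indicator_self_add_compl S σ
  have hτ := Set.indicator_self_add_compl S τ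
  simp only [Splits, Set.indicator_add'] at h ⊢
  generalize S.indicator σ = σ₁, Sᶜ.indicator σ = σ₂, S.indicator τ = τ₁,
    Sᶜ.indicator τ = τ₂ at *
  subst hσ hτ
  by_cases h₁ : σ₁ = 0 <;> by_cases h₂ : σ₂ = 0 <;> by_cases h₃ : τ₁ = 0 <;>
    by_cases h₄ : τ₂ = 0 <;> simp_all

/-- The support of `ρ` cannot be split into two parts at distance more than `m`. -/
def ChainConnected (bc : BC) (m : ℕ) (ρ : Site L → ℤ) : Prop :=
  ∀ S : Set (Site L), Splits S ρ → distance bc (S.indicator ρ) (Sᶜ.indicator ρ) ≤ m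

/-- No neutral part `ρ'` of `ρ` is at distance at least `M d(ρ')^α` from the rest of `ρ`. -/
def NeutralIrreducible (bc : BC) (α : ℝ) (ρ : Site L → ℤ) : Prop :=
  ∀ S : Set (Site L), Splits S ρ →
    Reaches bc α (S.indicator ρ) (distance bc (S.indicator ρ) (Sᶜ.indicator ρ))

lemma ChainConnected.mono {m' : ℕ} (h : ChainConnected bc m ρ) (hm : m ≤ m') :
    ChainConnected bc m' ρ :=
  fun S hS => (h S hS).trans hm

@[simp]
lemma distance_neg_left (σ τ : Site L → ℤ) : distance bc (-σ) τ = distance bc σ τ := by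
  simp [distance]

@[simp]
lemma splits_neg : Splits S (-ρ) ↔ Splits S ρ := by
  simp [Splits, Set.indicator_neg']

@[simp]
lemma chainConnected_neg : ChainConnected bc m (-ρ) ↔ ChainConnected bc m ρ := by
  simp [ChainConnected, Set.indicator_neg']

@[simp]
lemma neutralIrreducible_neg : NeutralIrreducible bc α (-ρ) ↔ NeutralIrreducible bc α ρ := by
  simp [NeutralIrreducible, Set.indicator_neg']

lemma Splits.distance_add_le (h : Splits S σ) (hdisj : Disjoint (supp σ) (supp τ)) :
    distance bc (S.indicator (σ + τ)) (Sᶜ.indicator (σ + τ)) ≤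
      distance bc (S.indicator σ) (Sᶜ.indicator σ) := by
  have hsub (S : Set (Site L)) : supp (S.indicator σ) ⊆ supp (S.indicator (σ + τ)) := by
    rw [Set.indicator_add', supp_add
      (hdisj.mono supp_indicator_subset supp_indicator_subset)]
    exact subset_union_left
  exact distance_anti h.1 h.2 (hsub S) (hsub Sᶜ)

/-- Two densities at distance `m`, reaching each other. -/
structure Linked (bc : BC) (α : ℝ) (m : ℕ) (σ τ : Site L → ℤ) : Prop where
  pos : 0 < m
  distance_eq : distance bc σ τ = m
  left : Reaches bc α σ m
  right : Reaches bc α τ m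

lemma Linked.symm (h : Linked bc α m σ τ) : Linked bc α m τ σ :=
  ⟨h.pos, (distance_comm bc τ σ).trans h.distance_eq, h.right, h.left⟩

lemma Linked.neg_right (h : Linked bc α m σ τ) : Linked bc α m σ (-τ) :=
  ⟨h.pos, by simp [h.distance_eq], h.left, reaches_neg.2 h.right⟩

lemma Linked.disjoint (h : Linked bc α m σ τ) : Disjoint (supp σ) (supp τ) :=
  disjoint_supp_of_distance_pos (bc := bc) (h.distance_eq ▸ h.pos)

lemma Linked.reaches_add (h : Linked bc α m σ τ) (hα : 1 ≤ α) : Reaches bc α (σ + τ) m :=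
  reaches_of_le_diam hα h.pos (h.distance_eq ▸ distance_le_diam_add h.disjoint)

lemma ChainConnected.add (h : Linked bc α m σ τ) (hσ : ChainConnected bc m σ)
    (hτ : ChainConnected bc m τ) : ChainConnected bc m (σ + τ) := by
  intro S hS
  rcases splits_add hS with hSσ | hSτ | ⟨hl, hr⟩ | ⟨hl, hr⟩
  · exact (hSσ.distance_add_le h.disjoint).trans (hσ S hSσ)
  · rw [add_comm σ τ]
    exact (hSτ.distance_add_le h.disjoint.symm).trans (hτ S hSτ)
  · rw [hl, hr, h.distance_eq]
  · rw [hl, hr, h.symm.distance_eq]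

lemma Linked.reaches_of_splits_left (h : Linked bc α m σ τ) (hα : 1 ≤ α)
    (hconn : ChainConnected bc m σ) (hirred : NeutralIrreducible bc α σ) (hS : Splits S σ) :
    Reaches bc α (S.indicator (σ + τ))
      (distance bc (S.indicator (σ + τ)) (Sᶜ.indicator (σ + τ))) := by
  have hle := hS.distance_add_le (bc := bc) h.disjoint
  by_cases hτ : S.indicator τ = 0
  · refine Reaches.mono ?_ hle
    rw [Set.indicator_add', hτ, add_zero]
    exact hirred S hS
  · -- The part of `σ + τ` in `S` meets both supports, hence has diameter at least `m`.
    refine (reaches_of_le_diam hα h.pos ?_).mono (hle.trans (hconn S hS))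
    calc m = distance bc σ τ := h.distance_eq.symm
      _ ≤ distance bc (S.indicator σ) (S.indicator τ) :=
          distance_anti hS.1 hτ supp_indicator_subset supp_indicator_subset
      _ ≤ diam bc (S.indicator (σ + τ)) := by
          rw [Set.indicator_add']
          exact distance_le_diam_add
            (h.disjoint.mono supp_indicator_subset supp_indicator_subset)

lemma NeutralIrreducible.add (h : Linked bc α m σ τ) (hα : 1 ≤ α)
    (hσ : ChainConnected bc m σ) (hτ : ChainConnected bc m τ)
    (hσ' : NeutralIrreducible bc α σ) (hτ' : NeutralIrreducible bc α τ) :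
    NeutralIrreducible bc α (σ + τ) := by
  intro S hS
  rcases splits_add hS with hSσ | hSτ | ⟨hl, hr⟩ | ⟨hl, hr⟩
  · exact h.reaches_of_splits_left hα hσ hσ' hSσ
  · rw [add_comm σ τ]
    exact h.symm.reaches_of_splits_left hα hτ hτ' hSτ
  · rw [hl, hr, h.distance_eq]
    exact h.left
  · rw [hl, hr, h.symm.distance_eq]
    exact h.right

/-- The sum of the cover numbers over the scales below `k`. -/
noncomputable def coverBelow (bc : BC) (k : ℕ) (ρ : Site L → ℤ) : ℕ :=
  ∑ j ∈ range k, coverNumber bc j ρ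

lemma coverBelow_mono (ρ : Site L → ℤ) {k k' : ℕ} (h : k ≤ k') :
    coverBelow bc k ρ ≤ coverBelow bc k' ρ :=
  sum_le_sum_of_subset (range_mono h)

@[simp]
lemma coverBelow_neg (k : ℕ) (ρ : Site L → ℤ) : coverBelow bc k (-ρ) = coverBelow bc k ρ := by
  simp [coverBelow]

lemma coverBelow_add_le {k : ℕ} (h : 2 ^ k ≤ distance bc σ τ) :
    coverBelow bc k σ + coverBelow bc k τ ≤ coverBelow bc k (σ + τ) := by
  rw [coverBelow, coverBelow, ← sum_add_distrib]
  exact sum_le_sum fun j hj => coverNumber_add_le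
    ((Nat.pow_le_pow_right two_pos (mem_range.1 hj)).trans h)

lemma coverSum_neg (ρ : Site L → ℤ) : coverSum bc α (-ρ) = coverSum bc α ρ := by
  simp [coverSum, scale]

lemma coverBelow_le_coverSum (hα : 1 ≤ α) {k : ℕ}
    (h : (2 : ℝ) ^ k < M * (diam bc ρ : ℝ) ^ α) :
    coverBelow bc (k + 1) ρ ≤ coverSum bc α ρ := by
  have hdiam : diam bc ρ ≠ 0 := by
    intro h0
    rw [h0, Nat.cast_zero, Real.zero_rpow (by linarith), mul_zero] at h
    exact absurd h (not_lt.2 (by positivity))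
  have hscale : k ≤ scale bc α ρ := by
    have hlogb : (k : ℝ) ≤ Real.logb 2 (M * (diam bc ρ : ℝ) ^ α) := by
      rw [Real.le_logb_iff_rpow_le one_lt_two (lt_trans (by positivity) h), Real.rpow_natCast]
      exact h.le
    exact_mod_cast hlogb.trans (Nat.le_ceil _)
  rw [coverSum, if_neg hdiam]
  exact coverBelow_mono ρ (Nat.succ_le_succ hscale)

open Classical in
/-- The bound, up to a factor `100`, for the number of factors `3` gathered by a density. The
value for a charged density is irrelevant, except that it has to include every scale `k ≤ L`. -/
noncomputable def maxExponent (bc : BC) (α : ℝ) (ρ : Site L → ℤ) : ℕ :=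
  if Neutral ρ then coverSum bc α ρ else coverBelow bc (L + 1) ρ

@[simp]
lemma maxExponent_neg (ρ : Site L → ℤ) : maxExponent bc α (-ρ) = maxExponent bc α ρ := by
  by_cases h : Neutral ρ <;> simp [maxExponent, h, coverSum_neg]

lemma coverBelow_le_maxExponent (hα : 1 ≤ α) {k : ℕ} (hk : k ≤ L)
    (h : Reaches bc α ρ (2 ^ k)) : coverBelow bc (k + 1) ρ ≤ maxExponent bc α ρ := by
  unfold maxExponent
  split_ifs with hn
  · exact coverBelow_le_coverSum hα (by exact_mod_cast h hn)
  · exact coverBelow_mono ρ (Nat.succ_le_succ hk)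

end Densities

/-- A density together with the number of factors `3` it has gathered; the marks are sites which
account for the factors gathered at the current scale. -/
structure Cluster (L : ℕ) where
  dens : Site L → ℤ
  exponent : ℕ
  marks : Finset (Site L)

namespace Cluster

variable {L : ℕ}

/-- The cluster with the opposite density. -/
def neg (x : Cluster L) : Cluster L := ⟨-x.dens, x.exponent, x.marks⟩

/-- The cluster resulting from two clusters that are merged. -/
def merge (x y : Cluster L) : Cluster L :=
  ⟨x.dens + y.dens, x.exponent + y.exponent + 1, x.marks ∪ y.marks⟩

/-- The cluster `x` after it has been compared, but not merged, with a cluster containing `t`. -/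
def survive (x : Cluster L) (t : Site L) : Cluster L :=
  ⟨x.dens, x.exponent + 1, insert t x.marks⟩

/-- The cluster `x` at the beginning of a new scale, with a single mark. -/
def restart (x : Cluster L) (t : Site L) : Cluster L := ⟨x.dens, x.exponent, {t}⟩

end Cluster

section Clusters

variable {bc : BC} {α : ℝ} {L k m : ℕ} {x y w : Cluster L} {s : Finset (Cluster L)}

/-- The properties of a single cluster while pairs at distance `m` are treated, where
`2 ^ k ≤ m ≤ 2 ^ (k + 1)`. A density that does not reach the distance `2 ^ k` gathers no more
factors `3`; in the bound for the others, `+ 1` pays for the factor `3` of a merge. -/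
structure ClusterInv (bc : BC) (α : ℝ) (k m : ℕ) (x : Cluster L) : Prop where
  ne_zero : x.dens ≠ 0
  chain : ChainConnected bc m x.dens
  irred : NeutralIrreducible bc α x.dens
  inactive : ¬ Reaches bc α x.dens (2 ^ k) → x.exponent ≤ 100 * maxExponent bc α x.dens
  active : Reaches bc α x.dens (2 ^ k) →
    x.exponent + 1 ≤ 100 * coverBelow bc k x.dens + #x.marks
  sep : (x.marks : Set (Site L)).Pairwise fun p q => 2 ^ k ≤ (domain bc L).dist p q
  near : ∀ t ∈ x.marks, ∃ i ∈ supp x.dens, (domain bc L).dist i t < 2 ^ (k + 1)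

/-- Two densities at distance less than `m` do not both reach each other. -/
def FarApart (bc : BC) (α : ℝ) (m : ℕ) (σ τ : Site L → ℤ) : Prop :=
  Reaches bc α σ (distance bc σ τ) → Reaches bc α τ (distance bc σ τ) → m ≤ distance bc σ τ

/-- The properties of a pair of clusters while pairs at distance `m` are treated, where
`2 ^ k ≤ m ≤ 2 ^ (k + 1)`. -/
structure PairInv (bc : BC) (α : ℝ) (k m : ℕ) (x y : Cluster L) : Prop where
  disjoint : Disjoint (supp x.dens) (supp y.dens)
  far : FarApart bc α m x.dens y.dens
  sep : Reaches bc α x.dens (2 ^ k) → Reaches bc α y.dens (2 ^ k) →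
    ∀ p ∈ supp x.dens ∪ x.marks, ∀ q ∈ supp y.dens ∪ y.marks, 2 ^ k ≤ (domain bc L).dist p q

lemma PairInv.symm (h : PairInv bc α k m x y) : PairInv bc α k m y x where
  disjoint := h.disjoint.symm
  far hy hx := by
    rw [distance_comm] at hx hy ⊢
    exact h.far hx hy
  sep hy hx p hp q hq := SimpleGraph.dist_comm (G := domain bc L) ▸ h.sep hx hy q hq p hp

instance : Std.Symm (PairInv (L := L) bc α k m) := ⟨fun _ _ h => h.symm⟩

lemma ClusterInv.neg (h : ClusterInv bc α k m x) : ClusterInv bc α k m x.neg where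
  ne_zero := neg_ne_zero.2 h.ne_zero
  chain := chainConnected_neg.2 h.chain
  irred := neutralIrreducible_neg.2 h.irred
  inactive := by simpa only [Cluster.neg, reaches_neg, maxExponent_neg] using h.inactive
  active := by simpa only [Cluster.neg, reaches_neg, coverBelow_neg] using h.active
  sep := h.sep
  near := by simpa only [Cluster.neg, supp_neg] using h.near

lemma PairInv.neg_right (h : PairInv bc α k m x y) : PairInv bc α k m x y.neg where
  disjoint := by simpa only [Cluster.neg, supp_neg] using h.disjoint
  far := by simpa only [Cluster.neg, FarApart, reaches_neg, distance_neg_right] using h.far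
  sep := by simpa only [Cluster.neg, reaches_neg, supp_neg] using h.sep

lemma PairInv.disjoint_marks (hxy : PairInv bc α k m x y) (hx : Reaches bc α x.dens (2 ^ k))
    (hy : Reaches bc α y.dens (2 ^ k)) :
    Disjoint (supp x.dens ∪ x.marks) (supp y.dens ∪ y.marks) :=
  disjoint_left.2 fun p hp hq => (Nat.two_pow_pos k).not_ge <| by
    simpa using hxy.sep hx hy p hp p hq

lemma ClusterInv.merge (hx : ClusterInv bc α k m x) (hy : ClusterInv bc α k m y)
    (hxy : PairInv bc α k m x y) (h : Linked bc α m x.dens y.dens) (hα : 1 ≤ α)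
    (hk : 2 ^ k ≤ m) : ClusterInv bc α k m (x.merge y) := by
  have hxk := h.left.mono hk
  have hyk := h.right.mono hk
  have hmarks := (hxy.disjoint_marks hxk hyk).mono subset_union_right subset_union_right
  refine ⟨?_, hx.chain.add h hy.chain, hx.irred.add h hα hx.chain hy.chain hy.irred,
    fun hn => absurd ((h.reaches_add hα).mono hk) hn, fun _ => ?_, ?_, fun t ht => ?_⟩
  · rw [Cluster.merge, ← supp_nonempty, supp_add h.disjoint]
    exact (supp_nonempty.2 hx.ne_zero).inl
  · have hcover := coverBelow_add_le (hk.trans h.distance_eq.ge)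
    have := hx.active hxk
    have := hy.active hyk
    simp only [Cluster.merge, card_union_of_disjoint hmarks]
    omega
  · rw [Cluster.merge, coe_union, Set.pairwise_union]
    refine ⟨hx.sep, hy.sep, fun p hp q hq _ => ?_⟩
    have hpq := hxy.sep hxk hyk p (mem_union_right _ hp) q (mem_union_right _ hq)
    exact ⟨hpq, SimpleGraph.dist_comm (G := domain bc L) ▸ hpq⟩
  · rw [Cluster.merge, supp_add h.disjoint]
    rcases mem_union.1 ht with ht | ht
    · obtain ⟨i, hi, hit⟩ := hx.near t ht
      exact ⟨i, mem_union_left _ hi, hit⟩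
    · obtain ⟨i, hi, hit⟩ := hy.near t ht
      exact ⟨i, mem_union_right _ hi, hit⟩

lemma PairInv.merge (hx : PairInv bc α k m x w) (hy : PairInv bc α k m y w)
    (h : Linked bc α m x.dens y.dens) (hx0 : x.dens ≠ 0) (hy0 : y.dens ≠ 0) (hw0 : w.dens ≠ 0)
    (hk : 2 ^ k ≤ m) : PairInv bc α k m (x.merge y) w where
  disjoint := by
    rw [Cluster.merge, supp_add h.disjoint, disjoint_union_left]
    exact ⟨hx.disjoint, hy.disjoint⟩
  far _ hw := by
    rw [Cluster.merge, distance_add_left bc hx0 hy0 h.disjoint hw0] at hw ⊢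
    by_contra! hlt
    rcases min_choice (distance bc x.dens w.dens) (distance bc y.dens w.dens) with he | he <;>
      rw [he] at hw hlt
    · exact hlt.not_ge (hx.far (h.left.mono hlt.le) hw)
    · exact hlt.not_ge (hy.far (h.right.mono hlt.le) hw)
  sep _ hw p hp q hq := by
    rw [Cluster.merge, supp_add h.disjoint, union_union_union_comm, mem_union] at hp
    exact hp.elim (fun hp => hx.sep (h.left.mono hk) hw p hp q hq)
      fun hp => hy.sep (h.right.mono hk) hw p hp q hq

lemma ClusterInv.survive (hx : ClusterInv bc α k m x) (hxy : PairInv bc α k m x y)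
    (h : Linked bc α m x.dens y.dens) (hk : 2 ^ k ≤ m) (hm : m < 2 ^ (k + 1)) {i t : Site L}
    (hi : i ∈ supp x.dens) (ht : t ∈ supp y.dens) (hit : (domain bc L).dist i t = m) :
    ClusterInv bc α k m (x.survive t) := by
  have hxk := h.left.mono hk
  have hyk := h.right.mono hk
  have htx : t ∉ x.marks := fun htx => disjoint_left.1 (hxy.disjoint_marks hxk hyk)
    (mem_union_right _ htx) (mem_union_left _ ht)
  refine ⟨hx.ne_zero, hx.chain, hx.irred, fun hn => absurd hxk hn, fun _ => ?_, ?_, fun p hp => ?_⟩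
  · have := hx.active hxk
    simp only [Cluster.survive, card_insert_of_notMem htx]
    omega
  · rw [Cluster.survive, coe_insert, Set.pairwise_insert]
    refine ⟨hx.sep, fun p hp _ => ?_⟩
    have hpt := hxy.sep hxk hyk p (mem_union_right _ hp) t (mem_union_left _ ht)
    exact ⟨SimpleGraph.dist_comm (G := domain bc L) ▸ hpt, hpt⟩
  · rcases mem_insert.1 hp with rfl | hp
    · exact ⟨i, hi, hit.trans_lt hm⟩
    · exact hx.near p hp

lemma PairInv.survive (hx : PairInv bc α k m x w) (hy : PairInv bc α k m y w)
    (h : Linked bc α m x.dens y.dens) (hk : 2 ^ k ≤ m) {t : Site L} (ht : t ∈ supp y.dens) :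
    PairInv bc α k m (x.survive t) w where
  disjoint := hx.disjoint
  far := hx.far
  sep hxk hw p hp q hq := by
    rw [Cluster.survive, union_insert, mem_insert] at hp
    rcases hp with rfl | hp
    · exact hy.sep (h.right.mono hk) hw p (mem_union_left _ ht) q hq
    · exact hx.sep hxk hw p hp q hq

/-- The properties of a family of clusters while pairs at distance `m` are treated, where
`2 ^ k ≤ m ≤ 2 ^ (k + 1)`. -/
structure FamilyInv (bc : BC) (α : ℝ) (k m : ℕ) (s : Finset (Cluster L)) : Prop where
  cluster : ∀ x ∈ s, ClusterInv bc α k m x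
  pair : (s : Set (Cluster L)).Pairwise (PairInv bc α k m)

lemma FamilyInv.mono {r : Finset (Cluster L)} (h : FamilyInv bc α k m s) (hr : r ⊆ s) :
    FamilyInv bc α k m r :=
  ⟨fun x hx => h.cluster x (hr hx), h.pair.mono (coe_subset.2 hr)⟩

lemma FamilyInv.insert [DecidableEq (Cluster L)] (h : FamilyInv bc α k m s)
    (hx : ClusterInv bc α k m x) (hxs : ∀ w ∈ s, PairInv bc α k m x w) :
    FamilyInv bc α k m (insert x s) where
  cluster := forall_mem_insert _ _ _ |>.2 ⟨hx, h.cluster⟩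
  pair := by
    rw [coe_insert]
    exact h.pair.insert_of_symm fun w hw _ => hxs w hw

lemma ClusterInv.notMem (hx : ClusterInv bc α k m x) (hxs : ∀ w ∈ s, PairInv bc α k m x w) :
    x ∉ s := fun hxs' =>
  hx.ne_zero (supp_eq_empty.1 (disjoint_self.1 (hxs x hxs').disjoint))

lemma FamilyInv.succ_or_linked (h : FamilyInv bc α k m s) (hm : 0 < m) :
    FamilyInv bc α k (m + 1) s ∨ ∃ x ∈ s, ∃ y ∈ s, x ≠ y ∧ Linked bc α m x.dens y.dens := by
  by_cases hfar : (s : Set (Cluster L)).Pairwise fun x y => FarApart bc α (m + 1) x.dens y.dens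
  · refine .inl ⟨fun x hx => ?_, fun x hx y hy hne => ?_⟩
    · exact { h.cluster x hx with chain := (h.cluster x hx).chain.mono m.le_succ }
    · exact { h.pair hx hy hne with far := hfar hx hy hne }
  · simp only [Set.Pairwise, FarApart] at hfar
    push Not at hfar
    obtain ⟨x, hx, y, hy, hne, hrx, hry, hlt⟩ := hfar
    have heq : distance bc x.dens y.dens = m :=
      le_antisymm (Nat.lt_succ_iff.1 hlt) ((h.pair hx hy hne).far hrx hry)
    exact .inr ⟨x, hx, y, hy, hne, hm, heq, heq ▸ hrx, heq ▸ hry⟩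

lemma ClusterInv.exponent_le (h : ClusterInv bc α k m x) (hr : Reaches bc α x.dens (2 ^ k)) :
    x.exponent ≤ 100 * coverBelow bc (k + 1) x.dens := by
  have := h.active hr
  have := card_le_hundred_mul_coverNumber h.sep h.near
  have : coverBelow bc (k + 1) x.dens = coverBelow bc k x.dens + coverNumber bc k x.dens :=
    sum_range_succ _ _
  omega

lemma ClusterInv.exponent_le_maxExponent (h : ClusterInv bc α k m x) (hα : 1 ≤ α) (hk : k ≤ L) :
    x.exponent ≤ 100 * maxExponent bc α x.dens := by
  by_cases hr : Reaches bc α x.dens (2 ^ k)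
  · exact (h.exponent_le hr).trans (Nat.mul_le_mul_left _ (coverBelow_le_maxExponent hα hk hr))
  · exact h.inactive hr

lemma ClusterInv.restart (h : ClusterInv bc α k m x) (hα : 1 ≤ α) (hk : k ≤ L) {t : Site L}
    (ht : t ∈ supp x.dens) : ClusterInv bc α (k + 1) m (x.restart t) where
  ne_zero := h.ne_zero
  chain := h.chain
  irred := h.irred
  inactive _ := h.exponent_le_maxExponent hα hk
  active hr := Nat.succ_le_succ
    (h.exponent_le (hr.mono (Nat.pow_le_pow_right two_pos k.le_succ)))
  sep := by simp [Cluster.restart]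
  near p hp := ⟨t, ht, by simp [mem_singleton.1 hp]⟩

lemma PairInv.restart (h : PairInv bc α k (2 ^ (k + 1)) x y) {t u : Site L}
    (ht : t ∈ supp x.dens) (hu : u ∈ supp y.dens) :
    PairInv bc α (k + 1) (2 ^ (k + 1)) (x.restart t) (y.restart u) where
  disjoint := h.disjoint
  far := h.far
  sep hx hy p hp q hq := by
    rw [Cluster.restart, union_eq_left.2 (singleton_subset_iff.2 ‹_›)] at hp hq
    have hpq := distance_le (bc := bc) hp hq
    by_contra! hlt
    exact hlt.not_ge ((h.far (hx.mono (hpq.trans hlt.le)) (hy.mono (hpq.trans hlt.le))).trans hpq)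

lemma FamilyInv.restart [DecidableEq (Cluster L)] (h : FamilyInv bc α k (2 ^ (k + 1)) s)
    (hα : 1 ≤ α) (hk : k ≤ L) {t : Cluster L → Site L} (ht : ∀ x ∈ s, t x ∈ supp x.dens) :
    FamilyInv bc α (k + 1) (2 ^ (k + 1)) (s.image fun x => x.restart (t x)) where
  cluster := forall_mem_image.2 fun x hx => (h.cluster x hx).restart hα hk (ht x hx)
  pair := by
    rw [coe_image]
    rintro _ ⟨x, hx, rfl⟩ _ ⟨y, hy, rfl⟩ hne
    exact (h.pair hx hy fun he => hne (he ▸ rfl)).restart (ht x hx) (ht y hy)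

lemma FamilyInv.injOn_dens (h : FamilyInv bc α k m s) :
    Set.InjOn Cluster.dens (s : Set (Cluster L)) := by
  intro x hx y hy hxy
  by_contra hne
  have hdisj := (h.pair hx hy hne).disjoint
  rw [hxy, disjoint_self] at hdisj
  exact (h.cluster y hy).ne_zero (supp_eq_empty.1 hdisj)

end Clusters

section Products

variable {bc : BC} {α : ℝ} {L k m : ℕ} {ρ σ τ : Site L → ℤ} {lamHat : Site L → ℕ → ℝ}

/-- The product of the coefficients `e^{ρ(j)²} λ̂_j(|ρ(j)|)` over the support of `ρ`. -/
noncomputable def activity (lamHat : Site L → ℕ → ℝ) (ρ : Site L → ℤ) : ℝ :=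
  ∏ j ∈ supp ρ, (Real.exp ((ρ j : ℝ) ^ 2) * lamHat j (ρ j).natAbs)

lemma activity_neg (lamHat : Site L → ℕ → ℝ) (ρ : Site L → ℤ) :
    activity lamHat (-ρ) = activity lamHat ρ := by
  simp [activity]

lemma activity_add (lamHat : Site L → ℕ → ℝ) (h : Disjoint (supp σ) (supp τ)) :
    activity lamHat (σ + τ) = activity lamHat σ * activity lamHat τ := by
  rw [activity, supp_add h, prod_union h]
  congr 1 <;> refine prod_congr rfl fun j hj => ?_
  · have hτ : τ j = 0 := by simpa using disjoint_left.1 h hj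
    simp [hτ]
  · have hσ : σ j = 0 := by simpa using disjoint_right.1 h hj
    simp [hσ]

lemma pairing_add (ψ : Site L → ℝ) (σ τ : Site L → ℤ) :
    pairing ψ (σ + τ) = pairing ψ σ + pairing ψ τ := by
  simp [pairing, mul_add, sum_add_distrib]

lemma pairing_neg (ψ : Site L → ℝ) (ρ : Site L → ℤ) : pairing ψ (-ρ) = -pairing ψ ρ := by
  simp [pairing]

/-- The factor of a cluster, as a function of the field `ψ`. -/
noncomputable def Cluster.factor (lamHat : Site L → ℕ → ℝ) (x : Cluster L) (ψ : Site L → ℝ) : ℝ :=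
  1 + 3 ^ x.exponent * activity lamHat x.dens * Real.cos (pairing ψ x.dens)

/-- The product of the factors of the clusters of a family, as a function of the field. -/
noncomputable def clusterProd (lamHat : Site L → ℕ → ℝ) (s : Finset (Cluster L)) :
    (Site L → ℝ) → ℝ :=
  ∏ x ∈ s, x.factor lamHat

lemma factor_mul_factor (lamHat : Site L → ℕ → ℝ) {x y : Cluster L} (i t : Site L)
    (h : Disjoint (supp x.dens) (supp y.dens)) :
    x.factor lamHat * y.factor lamHat =
      (1 / 3 : ℝ) • (x.survive t).factor lamHat + (1 / 3 : ℝ) • (y.survive i).factor lamHat +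
        (1 / 6 : ℝ) • (x.merge y).factor lamHat + (1 / 6 : ℝ) • (x.merge y.neg).factor lamHat := by
  have h' : Disjoint (supp x.dens) (supp (-y.dens)) := by rwa [supp_neg]
  funext ψ
  simp only [Pi.mul_apply, Pi.add_apply, Pi.smul_apply, smul_eq_mul, Cluster.factor,
    Cluster.survive, Cluster.merge, Cluster.neg, activity_add lamHat h, activity_add lamHat h',
    activity_neg, pairing_add, pairing_neg, Real.cos_add, Real.cos_neg, Real.sin_neg, pow_add,
    pow_one]
  ring

lemma combination_mem_of_convex {V : Type*} [AddCommGroup V] [Module ℝ V] {H : Set V}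
    (hH : Convex ℝ H) {a b c d : V} (ha : a ∈ H) (hb : b ∈ H) (hc : c ∈ H) (hd : d ∈ H) :
    (1 / 3 : ℝ) • a + (1 / 3 : ℝ) • b + (1 / 6 : ℝ) • c + (1 / 6 : ℝ) • d ∈ H := by
  have hab := hH ha hb (a := 1 / 2) (b := 1 / 2) (by norm_num) (by norm_num) (by norm_num)
  have hcd := hH hc hd (a := 1 / 2) (b := 1 / 2) (by norm_num) (by norm_num) (by norm_num)
  convert hH hab hcd (a := 2 / 3) (b := 1 / 3) (by norm_num) (by norm_num) (by norm_num) using 1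
  module

variable {H : Set ((Site L → ℝ) → ℝ)}

lemma clusterProd_mem_of_linked {r : Finset (Cluster L)} {x y : Cluster L} (hH : Convex ℝ H)
    (hα : 1 ≤ α) (hk : 2 ^ k ≤ m) (hm : m < 2 ^ (k + 1)) [DecidableEq (Cluster L)]
    (hxr : x ∉ insert y r) (hyr : y ∉ r) (h : FamilyInv bc α k m (insert x (insert y r)))
    (hlink : Linked bc α m x.dens y.dens)
    (hmem : ∀ z, z ∉ r → FamilyInv bc α k m (insert z r) → clusterProd lamHat (insert z r) ∈ H) :
    clusterProd lamHat (insert x (insert y r)) ∈ H := by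
  have hsub : r ⊆ insert x (insert y r) := (subset_insert y r).trans (subset_insert x _)
  have hr := h.mono hsub
  have hx := h.cluster x (mem_insert_self _ _)
  have hy := h.cluster y (by simp)
  have hxy : PairInv bc α k m x y :=
    h.pair (by simp) (by simp) (ne_of_mem_of_not_mem (mem_insert_self y r) hxr).symm
  have hxw : ∀ w ∈ r, PairInv bc α k m x w := fun w hw =>
    h.pair (by simp) (hsub hw) (ne_of_mem_of_not_mem (mem_insert_of_mem hw) hxr).symm
  have hyw : ∀ w ∈ r, PairInv bc α k m y w := fun w hw =>
    h.pair (by simp) (hsub hw) (ne_of_mem_of_not_mem hw hyr).symm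
  have hmem' (z : Cluster L) (hz : ClusterInv bc α k m z) (hzw : ∀ w ∈ r, PairInv bc α k m z w) :
      z.factor lamHat * clusterProd lamHat r ∈ H := by
    rw [clusterProd, ← prod_insert (hz.notMem hzw)]
    exact hmem z (hz.notMem hzw) (hr.insert hz hzw)
  have hmerge {y : Cluster L} (hy : ClusterInv bc α k m y) (hxy : PairInv bc α k m x y)
      (hlink : Linked bc α m x.dens y.dens) (hyw : ∀ w ∈ r, PairInv bc α k m y w) :=
    hmem' (x.merge y) (hx.merge hy hxy hlink hα hk) fun w hw =>
      (hxw w hw).merge (hyw w hw) hlink hx.ne_zero hy.ne_zero (hr.cluster w hw).ne_zero hk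
  obtain ⟨i, hi, t, ht, hit⟩ := exists_distance_eq bc hx.ne_zero hy.ne_zero
  replace hit : (domain bc L).dist i t = m := hit.symm.trans hlink.distance_eq
  rw [clusterProd, prod_insert hxr, prod_insert hyr, ← mul_assoc,
    factor_mul_factor lamHat i t hlink.disjoint]
  simp only [add_mul, smul_mul_assoc]
  refine combination_mem_of_convex hH (hmem' _ ?_ ?_) (hmem' _ ?_ ?_)
    (hmerge hy hxy hlink hyw) (hmerge hy.neg hxy.neg_right hlink.neg_right
      fun w hw => (hyw w hw).symm.neg_right.symm)
  · exact hx.survive hxy hlink hk hm hi ht hit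
  · exact fun w hw => (hxw w hw).survive (hyw w hw) hlink hk ht
  · exact hy.survive hxy.symm hlink.symm hk hm ht hi (SimpleGraph.dist_comm.trans hit)
  · exact fun w hw => (hyw w hw).survive (hxw w hw) hlink.symm hk hi

lemma clusterProd_mem_of_succ (hH : Convex ℝ H) (hα : 1 ≤ α) (hk : 2 ^ k ≤ m)
    (hm : m < 2 ^ (k + 1))
    (hsucc : ∀ s, FamilyInv bc α k (m + 1) s → clusterProd lamHat s ∈ H)
    (s : Finset (Cluster L)) (h : FamilyInv bc α k m s) : clusterProd lamHat s ∈ H := by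
  classical
  induction hn : #s generalizing s with
  | zero =>
    rw [card_eq_zero.1 hn]
    exact hsucc ∅ ⟨by simp, by simp⟩
  | succ n ih =>
    obtain h' | ⟨x, hx, y, hy, hne, hlink⟩ := h.succ_or_linked (hk.trans_lt' (Nat.two_pow_pos k))
    · exact hsucc s h'
    set r := (s.erase x).erase y with hr
    have hys : insert y r = s.erase x := insert_erase (mem_erase.2 ⟨hne.symm, hy⟩)
    have hxs : insert x (insert y r) = s := by rw [hys, insert_erase hx]
    have hyr : y ∉ r := notMem_erase _ _
    have hcard : #r + 1 = n := by
      rw [← card_insert_of_notMem hyr, hys, card_erase_of_mem hx, hn, Nat.add_sub_cancel]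
    rw [← hxs] at h ⊢
    refine clusterProd_mem_of_linked hH hα hk hm (by simp [hys]) hyr h hlink fun z hz hzr => ?_
    exact ih _ hzr (by rw [card_insert_of_notMem hz, hcard])

lemma clusterProd_mem_of_next_scale (hH : Convex ℝ H) (hα : 1 ≤ α)
    (hnext : ∀ s, FamilyInv bc α k (2 ^ (k + 1)) s → clusterProd lamHat s ∈ H)
    (s : Finset (Cluster L)) (h : FamilyInv bc α k (2 ^ k) s) : clusterProd lamHat s ∈ H := by
  suffices hall : ∀ m ≤ 2 ^ (k + 1), 2 ^ k ≤ m →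
      ∀ s, FamilyInv bc α k m s → clusterProd lamHat s ∈ H from
    hall _ (Nat.pow_le_pow_right two_pos k.le_succ) le_rfl s h
  intro m hm
  induction hm using Nat.decreasingInduction with
  | self => exact fun _ => hnext
  | of_succ m hm ih =>
    exact fun hk => clusterProd_mem_of_succ hH hα hk hm (ih (hk.trans m.le_succ))

lemma clusterProd_mem_of_last_scale (hH : Convex ℝ H) (hα : 1 ≤ α)
    (hlast : ∀ s, FamilyInv bc α L (2 ^ (L + 1)) s → clusterProd lamHat s ∈ H) (hk : k ≤ L) :
    ∀ s, FamilyInv bc α k (2 ^ k) s → clusterProd lamHat s ∈ H := by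
  classical
  induction hk using Nat.decreasingInduction with
  | self => exact clusterProd_mem_of_next_scale hH hα hlast
  | of_succ k hk ih =>
    refine clusterProd_mem_of_next_scale hH hα fun s h => ?_
    have hsupp (x : Cluster L) (hx : x ∈ s) : ∃ t, t ∈ supp x.dens :=
      supp_nonempty.2 (h.cluster x hx).ne_zero
    obtain rfl | ⟨x, hx⟩ := s.eq_empty_or_nonempty
    · exact ih ∅ ⟨by simp, by simp⟩
    have : Nonempty (Site L) := (hsupp x hx).nonempty
    choose! t ht using hsupp
    have hinj : Set.InjOn (fun x : Cluster L => x.restart (t x)) s := fun x hx y hy hxy =>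
      h.injOn_dens hx hy (by simpa [Cluster.restart] using congrArg Cluster.dens hxy)
    have hprod := ih _ (h.restart hα hk.le ht)
    rwa [clusterProd, prod_image hinj] at hprod

/-- An ensemble of neutrally irreducible densities no two of which reach each other. -/
structure SeparatedEnsemble (bc : BC) (α : ℝ) (E : Finset (Site L → ℤ)) : Prop where
  isEnsemble : IsEnsemble E
  irred : ∀ ρ ∈ E, NeutralIrreducible bc α ρ
  not_reaches : ∀ σ ∈ E, ∀ τ ∈ E, σ ≠ τ →
    ¬ Reaches bc α σ (distance bc σ τ) ∨ ¬ Reaches bc α τ (distance bc σ τ)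

namespace SeparatedEnsemble

variable {E : Finset (Site L → ℤ)}

lemma eq_of_charged (h : SeparatedEnsemble bc α E) (hσ : σ ∈ E) (hτ : τ ∈ E) (hσ' : ¬ Neutral σ)
    (hτ' : ¬ Neutral τ) : σ = τ := by
  by_contra hne
  rcases h.not_reaches σ hσ τ hτ hne with hr | hr
  · exact hσ' (not_reaches_iff.1 hr).1
  · exact hτ' (not_reaches_iff.1 hr).1

lemma le_distance (h : SeparatedEnsemble bc α E) (hα : 0 ≤ α) (hσ : σ ∈ E) (hτ : τ ∈ E)
    (hne : σ ≠ τ) :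
    M * (min (diam bc σ : ℝ) (diam bc τ : ℝ)) ^ α ≤ (distance bc σ τ : ℝ) := by
  have hM : 0 ≤ M := by norm_num [M]
  rcases h.not_reaches σ hσ τ hτ hne with hr | hr
  · exact le_trans (by gcongr; exact min_le_left _ _) (not_reaches_iff.1 hr).2
  · exact le_trans (by gcongr; exact min_le_right _ _) (not_reaches_iff.1 hr).2

lemma le_distance_of_charged (h : SeparatedEnsemble bc α E) (hσ : σ ∈ E) (hτ : τ ∈ E)
    (hne : σ ≠ τ) (hτ' : ¬ Neutral τ) :
    M * (diam bc σ : ℝ) ^ α ≤ (distance bc σ τ : ℝ) :=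
  (h.not_reaches σ hσ τ hτ hne).elim (fun hr => (not_reaches_iff.1 hr).2)
    fun hr => absurd (not_reaches_iff.1 hr).1 hτ'

end SeparatedEnsemble

lemma NeutralIrreducible.reaches (h : NeutralIrreducible bc α (σ + τ))
    (hdisj : Disjoint (supp σ) (supp τ)) (hσ : σ ≠ 0) (hτ : τ ≠ 0) :
    Reaches bc α σ (distance bc σ τ) := by
  have hτ' : (Function.support σ).indicator (σ + τ) = σ := by
    ext j
    by_cases hj : σ j = 0
    · simp [hj]
    · have : τ j = 0 := by simpa using disjoint_left.1 hdisj (mem_supp.2 hj)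
      simp [hj, this]
  have hσ' : (Function.support σ)ᶜ.indicator (σ + τ) = τ := by
    rw [Set.indicator_compl, hτ', add_sub_cancel_left]
  simpa only [hσ', hτ'] using h (Function.support σ) ⟨hτ'.symm ▸ hσ, hσ'.symm ▸ hτ⟩

lemma NeutralIrreducible.not_neutral (h : NeutralIrreducible bc α (σ + τ))
    (hn : Neutral (σ + τ)) (hdisj : Disjoint (supp σ) (supp τ)) (hσ : σ ≠ 0) (hτ : τ ≠ 0)
    (hle : 2 * M * (min (diam bc σ : ℝ) (diam bc τ : ℝ)) ^ α ≤ (distance bc σ τ : ℝ)) :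
    ¬ Neutral σ ∧ ¬ Neutral τ := by
  have hiff : Neutral σ ↔ Neutral τ := by
    rw [Neutral, charge_add] at hn
    unfold Neutral
    omega
  rw [← hiff, and_self]
  intro hnσ
  have hltσ := h.reaches hdisj hσ hτ hnσ
  have hltτ := (add_comm σ τ ▸ h).reaches hdisj.symm hτ hσ (hiff.1 hnσ)
  rw [distance_comm] at hltτ
  have hM : 0 ≤ M := by norm_num [M]
  have hpos : 0 ≤ M * (min (diam bc σ : ℝ) (diam bc τ : ℝ)) ^ α := by positivity
  rcases min_choice (diam bc σ : ℝ) (diam bc τ : ℝ) with hmin | hmin <;>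
    rw [hmin] at hle hpos <;> linarith

lemma FamilyInv.separatedEnsemble [DecidableEq (Site L → ℤ)] {s : Finset (Cluster L)}
    (h : FamilyInv bc α L (2 ^ (L + 1)) s) : SeparatedEnsemble bc α (s.image Cluster.dens) where
  isEnsemble := by
    refine ⟨forall_mem_image.2 fun x hx => (h.cluster x hx).ne_zero, ?_⟩
    simp only [forall_mem_image]
    exact fun x hx y hy hne => (h.pair hx hy fun he => hne (he ▸ rfl)).disjoint
  irred := forall_mem_image.2 fun x hx => (h.cluster x hx).irred
  not_reaches := by
    simp only [forall_mem_image]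
    intro x hx y hy hne
    by_contra! hr
    have hfar := (h.pair hx hy fun he => hne (he ▸ rfl)).far hr.1 hr.2
    obtain ⟨i, -, j, -, hij⟩ :=
      exists_distance_eq bc (h.cluster x hx).ne_zero (h.cluster y hy).ne_zero
    have := dist_lt_two_mul bc i j
    have := Nat.lt_two_pow_self (n := L)
    omega

/-- The product `∏_{ρ ∈ E} [1 + K(ρ) cos⟨ψ, ρ⟩]`, as a function of `ψ`. -/
noncomputable def ensembleProd (K : (Site L → ℤ) → ℝ) (E : Finset (Site L → ℤ))
    (ψ : Site L → ℝ) : ℝ :=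
  ∏ ρ ∈ E, (1 + K ρ * Real.cos (pairing ψ ρ))

/-- The coefficient `K(ρ)`, with the maximal number of factors `3`. -/
noncomputable def coefficient (bc : BC) (α : ℝ) (lamHat : Site L → ℕ → ℝ) (ρ : Site L → ℤ) : ℝ :=
  3 ^ (100 * maxExponent bc α ρ) * activity lamHat ρ

lemma abs_coefficient_of_neutral (lamHat : Site L → ℕ → ℝ) (h : Neutral ρ) :
    |coefficient bc α lamHat ρ| = Real.exp (100 * Real.log 3 * (coverSum bc α ρ : ℝ)) *
      ∏ j ∈ supp ρ, (Real.exp ((ρ j : ℝ) ^ 2) * |lamHat j (ρ j).natAbs|) := by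
  have hexp : (3 : ℝ) ^ (100 * coverSum bc α ρ) =
      Real.exp (100 * Real.log 3 * (coverSum bc α ρ : ℝ)) := by
    rw [← Real.rpow_natCast, Real.rpow_def_of_pos three_pos]
    push_cast
    ring_nf
  rw [coefficient, maxExponent, if_pos h, abs_mul, activity, abs_prod, hexp, Real.abs_exp]
  simp only [abs_mul, Real.abs_exp]

lemma exists_factor_eq {x : Cluster L} (hx : x.exponent ≤ 100 * maxExponent bc α x.dens) :
    ∃ θ : ℝ, 0 ≤ θ ∧ θ ≤ 1 ∧ ∀ ψ, x.factor lamHat ψ =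
      θ * (1 + coefficient bc α lamHat x.dens * Real.cos (pairing ψ x.dens)) + (1 - θ) := by
  obtain ⟨d, hd⟩ := Nat.exists_eq_add_of_le hx
  refine ⟨(3 ^ d)⁻¹, by positivity, inv_le_one_of_one_le₀ (one_le_pow₀ (by norm_num)),
    fun ψ => ?_⟩
  rw [Cluster.factor, coefficient, hd, pow_add]
  field_simp
  ring

lemma FamilyInv.clusterProd_mem_convexHull {s : Finset (Cluster L)}
    (h : FamilyInv bc α L (2 ^ (L + 1)) s) (hα : 1 ≤ α) :
    clusterProd lamHat s ∈ convexHull ℝ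
      (ensembleProd (coefficient bc α lamHat) '' {E | SeparatedEnsemble bc α E}) := by
  classical
  have hfactor (x : Cluster L) (hx : x ∈ s) :=
    exists_factor_eq (lamHat := lamHat) ((h.cluster x hx).exponent_le_maxExponent hα le_rfl)
  choose! θ hθ0 hθ1 hθ using hfactor
  have hsum : clusterProd lamHat s = ∑ r ∈ s.powerset,
      ((∏ x ∈ r, θ x) * ∏ x ∈ s \ r, (1 - θ x)) •
        ensembleProd (coefficient bc α lamHat) (r.image Cluster.dens) := by
    funext ψ
    rw [clusterProd, prod_apply, prod_congr rfl fun x hx => hθ x hx ψ, prod_add, Finset.sum_apply]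
    refine sum_congr rfl fun r hr => ?_
    rw [Pi.smul_apply, smul_eq_mul, ensembleProd,
      prod_image (h.injOn_dens.mono (coe_subset.2 (mem_powerset.1 hr))), prod_mul_distrib]
    ring
  rw [hsum]
  refine (convex_convexHull ℝ _).sum_mem (fun r hr => ?_) ?_ fun r hr =>
    subset_convexHull ℝ _ ⟨_, (h.mono (mem_powerset.1 hr)).separatedEnsemble, rfl⟩
  · exact mul_nonneg (prod_nonneg fun x hx => hθ0 x (mem_powerset.1 hr hx))
      (prod_nonneg fun x hx => sub_nonneg.2 (hθ1 x (mem_sdiff.1 hx).1))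
  · rw [← prod_add]
    exact prod_eq_one fun x _ => add_sub_cancel _ _

lemma exists_weights_of_mem_convexHull {ι V : Type*} [AddCommGroup V] [Module ℝ V] {f : ι → V}
    {S : Set ι} {v : V} (hv : v ∈ convexHull ℝ (f '' S)) :
    ∃ (F : Finset ι) (c : ι → ℝ), (∀ i ∈ F, i ∈ S) ∧ (∀ i ∈ F, 0 < c i) ∧ ∑ i ∈ F, c i = 1 ∧
      ∑ i ∈ F, c i • f i = v := by
  obtain ⟨κ, _, z, w, hz, hind, hw, hw1, rfl⟩ := eq_pos_convex_span_of_mem_convexHull hv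
  choose g hgS hg using fun i => hz (Set.mem_range_self i)
  have hinj : Function.Injective g := fun a b hab => hind.injective (by rw [← hg, ← hg, hab])
  refine ⟨univ.map ⟨g, hinj⟩, Function.extend g w 0, ?_, ?_, ?_, ?_⟩
  · simpa using hgS
  · simpa [hinj.extend_apply] using hw
  · simpa [hinj.extend_apply] using hw1
  · simp [hinj.extend_apply, hg]

end Products

section Start

variable {bc : BC} {α : ℝ} {L : ℕ} {j : Site L} {q : ℕ}

lemma two_mul_sum_exp_neg_sq_le_one (N : ℕ) :
    2 * ∑ q ∈ Icc 1 N, Real.exp (-(q : ℝ) ^ 2) ≤ 1 := by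
  set x := Real.exp (-1) with hx
  have hx0 : 0 < x := Real.exp_pos _
  have hx1 : x < 2 / 5 := Real.exp_neg_one_lt_d9.trans (by norm_num)
  have hterm (q : ℕ) : Real.exp (-(q : ℝ) ^ 2) ≤ x⁻¹ * (x ^ 2) ^ q := by
    rw [hx, ← Real.exp_neg, ← Real.exp_nat_mul, ← Real.exp_nat_mul, ← Real.exp_add]
    refine Real.exp_le_exp.2 ?_
    push_cast
    linarith [sq_nonneg ((q : ℝ) - 1)]
  have hgeom : ∑ q ∈ Icc 1 N, (x ^ 2) ^ q ≤ (x ^ 2) ^ 1 / (1 - x ^ 2) := by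
    rw [← Ico_add_one_right_eq_Icc]
    exact geom_sum_Ico_le_of_lt_one (by positivity) (by nlinarith)
  have hpos : 0 < 1 - x ^ 2 := by nlinarith
  calc 2 * ∑ q ∈ Icc 1 N, Real.exp (-(q : ℝ) ^ 2)
      ≤ 2 * (x⁻¹ * ((x ^ 2) ^ 1 / (1 - x ^ 2))) := by
        grw [← hgeom, mul_sum _ _ x⁻¹]
        exact mul_le_mul_of_nonneg_left (sum_le_sum fun q _ => hterm q) two_pos.le
    _ = 2 * x / (1 - x ^ 2) := by field_simp
    _ ≤ 1 := by
        rw [div_le_one hpos]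
        nlinarith

/-- The contribution of the charge `q` to the product of the `λ_j` at a site with coefficients
`c` and field `φ`. -/
noncomputable def chargeFactor (c : ℕ → ℝ) (φ : ℝ) (q : ℕ) : ℝ :=
  if q = 0 then 1 else 1 + Real.exp ((q : ℝ) ^ 2) * c q * Real.cos (q * φ)

lemma IsTrigPoly.exists_weights {lam : ℝ → ℝ} {c : ℕ → ℝ} (h : IsTrigPoly lam c) :
    ∃ (Q : Finset ℕ) (w : ℕ → ℝ), (∀ q, 0 ≤ w q) ∧ ∑ q ∈ Q, w q = 1 ∧
      ∀ φ, lam φ = ∑ q ∈ Q, w q * chargeFactor c φ q := by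
  obtain ⟨N, -, -, hlam⟩ := h
  have h0 : 0 ∉ Icc 1 N := by simp
  have hne (q : ℕ) (hq : q ∈ Icc 1 N) : q ≠ 0 := ne_of_mem_of_not_mem hq h0
  let v (q : ℕ) : ℝ := 2 * Real.exp (-(q : ℝ) ^ 2)
  refine ⟨insert 0 (Icc 1 N), fun q => if q = 0 then 1 - ∑ q ∈ Icc 1 N, v q else v q,
    fun q => ?_, ?_, fun φ => ?_⟩
  · dsimp only
    split_ifs
    · rw [← mul_sum]
      exact sub_nonneg.2 (two_mul_sum_exp_neg_sq_le_one N)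
    · positivity
  · rw [sum_insert h0, if_pos rfl, sum_congr rfl fun q hq => if_neg (hne q hq), sub_add_cancel]
  · have hterm (q : ℕ) (hq : q ∈ Icc 1 N) :
        (if q = 0 then 1 - ∑ q ∈ Icc 1 N, v q else v q) * chargeFactor c φ q =
          v q + 2 * (c q * Real.cos (q * φ)) := by
      have hexp : Real.exp (-(q : ℝ) ^ 2) * Real.exp ((q : ℝ) ^ 2) = 1 := by
        rw [← Real.exp_add, neg_add_cancel, Real.exp_zero]
      rw [if_neg (hne q hq), chargeFactor, if_neg (hne q hq)]
      linear_combination (2 * c q * Real.cos (q * φ)) * hexp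
    rw [hlam, sum_insert h0, sum_congr rfl hterm, sum_add_distrib, mul_sum]
    simp only [chargeFactor, if_true]
    ring

lemma supp_single {a : ℤ} (ha : a ≠ 0) : supp (Pi.single j a : Site L → ℤ) = {j} := by
  ext i
  simp [Pi.single_apply, ha]

lemma not_splits_single {S : Set (Site L)} {a : ℤ} : ¬ Splits S (Pi.single j a) := by
  have hsupport : Function.support (Pi.single j a : Site L → ℤ) ⊆ {j} := Pi.support_single_subset
  rintro ⟨h₁, h₂⟩
  by_cases hj : j ∈ S
  · exact h₂ (Set.indicator_eq_zero.2 (.mono_left hsupport (by simpa using hj)))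
  · exact h₁ (Set.indicator_eq_zero.2 (.mono_left hsupport (by simpa using hj)))

/-- The cluster consisting of the charge `q` at the site `j`. -/
def Cluster.single (j : Site L) (q : ℕ) : Cluster L := ⟨Pi.single j (q : ℤ), 0, {j}⟩

lemma factor_single (lamHat : Site L → ℕ → ℝ) (ψ : Site L → ℝ) (hq : q ≠ 0) :
    (Cluster.single j q).factor lamHat ψ = chargeFactor (lamHat j) (ψ j) q := by
  have hpairing : pairing ψ (Pi.single j (q : ℤ)) = q * ψ j := by
    simp [pairing, Pi.single_apply, mul_comm]
  have hactivity : activity lamHat (Pi.single j (q : ℤ)) =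
      Real.exp ((q : ℝ) ^ 2) * lamHat j q := by
    rw [activity, supp_single (by exact_mod_cast hq), prod_singleton]
    simp
  simp [Cluster.factor, Cluster.single, chargeFactor, hq, hpairing, hactivity]

lemma clusterInv_single (hq : q ≠ 0) : ClusterInv bc α 0 (2 ^ 0) (Cluster.single j q) where
  ne_zero := by simpa [Cluster.single] using hq
  chain _ hS := absurd hS not_splits_single
  irred _ hS := absurd hS not_splits_single
  inactive _ := Nat.zero_le _
  active _ := by simp [Cluster.single]
  sep := by simp [Cluster.single]
  near t ht := ⟨t, by simpa [Cluster.single, supp_single, hq] using ht, by simp⟩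

lemma pairInv_single {i : Site L} {p : ℕ} (hp : p ≠ 0) (hq : q ≠ 0) (hij : i ≠ j) :
    PairInv bc α 0 (2 ^ 0) (Cluster.single i p) (Cluster.single j q) := by
  have hi : supp (Cluster.single i p).dens = {i} := supp_single (by exact_mod_cast hp)
  have hj : supp (Cluster.single j q).dens = {j} := supp_single (by exact_mod_cast hq)
  have hdist : 2 ^ 0 ≤ (domain bc L).dist i j :=
    (domain_preconnected bc L i j).pos_dist_of_ne hij
  refine ⟨by simpa [hi, hj] using hij, fun _ _ => ?_, fun _ _ => ?_⟩
  · obtain ⟨i', hi', j', hj', h⟩ := exists_distance_eq bc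
      (clusterInv_single (bc := bc) (α := α) hp).ne_zero
      (clusterInv_single (bc := bc) (α := α) hq).ne_zero
    rw [hi, mem_singleton] at hi'
    rw [hj, mem_singleton] at hj'
    rwa [h, hi', hj']
  · rw [hi, hj]
    simpa [Cluster.single] using hdist

/-- The clusters of a configuration of charges. -/
noncomputable def initialClusters [DecidableEq (Cluster L)] (η : Site L → ℕ) :
    Finset (Cluster L) :=
  image (fun j => Cluster.single j (η j)) {j | η j ≠ 0}

lemma familyInv_initialClusters [DecidableEq (Cluster L)] (η : Site L → ℕ) :
    FamilyInv bc α 0 (2 ^ 0) (initialClusters η) where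
  cluster := forall_mem_image.2 fun j hj => clusterInv_single (by simpa using hj)
  pair := by
    rw [initialClusters, coe_image]
    rintro _ ⟨i, hi, rfl⟩ _ ⟨j, hj, rfl⟩ hne
    exact pairInv_single (by simpa using hi) (by simpa using hj) fun h => hne (h ▸ rfl)

lemma clusterProd_initialClusters [DecidableEq (Cluster L)] (lamHat : Site L → ℕ → ℝ)
    (η : Site L → ℕ) (ψ : Site L → ℝ) :
    clusterProd lamHat (initialClusters η) ψ = ∏ j, chargeFactor (lamHat j) (ψ j) (η j) := by
  have hinj : Function.Injective fun j => Cluster.single j (η j) := fun i j h =>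
    singleton_injective (congrArg Cluster.marks h)
  rw [clusterProd, initialClusters, prod_image hinj.injOn, prod_apply, prod_filter]
  refine prod_congr rfl fun j _ => ?_
  split_ifs with hj
  · exact factor_single lamHat ψ hj
  · rw [chargeFactor, if_pos (not_not.1 hj)]

lemma prod_mem_convexHull (hα : 1 ≤ α) {lam : Site L → ℝ → ℝ} {lamHat : Site L → ℕ → ℝ}
    (hlam : ∀ j, IsTrigPoly (lam j) (lamHat j)) :
    (fun ψ => ∏ j, lam j (ψ j)) ∈ convexHull ℝ
      (ensembleProd (coefficient bc α lamHat) '' {E | SeparatedEnsemble bc α E}) := by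
  classical
  choose Q w hw0 hw1 hw using fun j => (hlam j).exists_weights
  have hsum : (fun ψ => ∏ j, lam j (ψ j)) = ∑ η ∈ Fintype.piFinset Q,
      (∏ j, w j (η j)) • clusterProd lamHat (initialClusters η) := by
    funext ψ
    simp only [hw, prod_univ_sum, Finset.sum_apply, Pi.smul_apply, smul_eq_mul,
      clusterProd_initialClusters, prod_mul_distrib]
  rw [hsum]
  refine (convex_convexHull ℝ _).sum_mem (fun η _ => prod_nonneg fun j _ => hw0 j _) ?_
    fun η _ => ?_
  · rw [← prod_univ_sum]
    exact prod_eq_one fun j _ => hw1 j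
  · exact clusterProd_mem_of_last_scale (convex_convexHull ℝ _) hα
      (fun s hs => hs.clusterProd_mem_convexHull hα) L.zero_le _ (familyInv_initialClusters η)

end Start

end BKT

open BKT in
theorem theorem2p2_general {α : ℝ} (hα : 1 ≤ α) (bc : BC) {L : ℕ}
    {lam : Site L → ℝ → ℝ} {lamHat : Site L → ℕ → ℝ}
    (hlam : ∀ j, IsTrigPoly (lam j) (lamHat j)) :
    ∃ (F : Finset (Finset (Site L → ℤ))) (c : Finset (Site L → ℤ) → ℝ)
      (K : (Site L → ℤ) → ℝ),
      (∀ E ∈ F, IsEnsemble E) ∧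
      (∀ E ∈ F, 0 < c E) ∧
      ∑ E ∈ F, c E = 1 ∧
      (∀ ψ : Site L → ℝ,
        ∏ j, lam j (ψ j) =
          ∑ E ∈ F, c E * ∏ ρ ∈ E, (1 + K ρ * Real.cos (pairing ψ ρ))) ∧
      ∀ E ∈ F,
        (∀ ρ₁ ∈ E, ∀ ρ₂ ∈ E, ¬ Neutral ρ₁ → ¬ Neutral ρ₂ → ρ₁ = ρ₂) ∧
        (∀ ρ₁ ∈ E, ∀ ρ₂ ∈ E, ρ₁ ≠ ρ₂ →
          M * (min (diam bc ρ₁ : ℝ) (diam bc ρ₂ : ℝ)) ^ α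
            ≤ (distance bc ρ₁ ρ₂ : ℝ)) ∧
        (∀ ρc ∈ E, ¬ Neutral ρc → ∀ ρ ∈ E, ρ ≠ ρc →
          M * (diam bc ρ : ℝ) ^ α ≤ (distance bc ρ ρc : ℝ)) ∧
        (∀ ρ ∈ E, Neutral ρ → ∀ ρ₁ ρ₂ : Site L → ℤ, ρ₁ ≠ 0 → ρ₂ ≠ 0 →
          Disjoint (supp ρ₁) (supp ρ₂) → ρ = ρ₁ + ρ₂ →
          2 * M * (min (diam bc ρ₁ : ℝ) (diam bc ρ₂ : ℝ)) ^ α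
            ≤ (distance bc ρ₁ ρ₂ : ℝ) →
          ¬ Neutral ρ₁ ∧ ¬ Neutral ρ₂) ∧
        (∀ ρ ∈ E, Neutral ρ →
          |K ρ| ≤ Real.exp (100 * Real.log 3 * (coverSum bc α ρ : ℝ)) *
            ∏ j ∈ supp ρ,
              (Real.exp ((ρ j : ℝ) ^ 2) * |lamHat j (ρ j).natAbs|)) := by
  obtain ⟨F, c, hF, hc, hsum, heq⟩ := exists_weights_of_mem_convexHull
    (prod_mem_convexHull (bc := bc) hα hlam)
  refine ⟨F, c, coefficient bc α lamHat, fun E hE => (hF E hE).isEnsemble, hc, hsum, fun ψ => ?_,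
    fun E hE => ⟨?_, ?_, ?_, ?_, ?_⟩⟩
  · simpa [ensembleProd] using (congrFun heq ψ).symm
  · exact fun σ hσ τ hτ => (hF E hE).eq_of_charged hσ hτ
  · exact fun σ hσ τ hτ => (hF E hE).le_distance (by linarith) hσ hτ
  · exact fun σ hσ hσ' τ hτ hne => (hF E hE).le_distance_of_charged hτ hσ hne hσ'
  · rintro _ hρ hn σ τ hσ hτ hdisj rfl hle
    exact ((hF E hE).irred _ hρ).not_neutral hn hdisj hσ hτ hle
  · exact fun ρ _ hn => (abs_coefficient_of_neutral lamHat hn).le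

theorem theorem2p2 :
    ∃ D₂ : ℝ, 0 < D₂ ∧
      ∀ (α : ℝ), 3 / 2 < α → α < 2 →
      ∀ (bc : BKT.BC) (L : ℕ), bc.Admissible L →
      ∀ (lam : BKT.Site L → ℝ → ℝ) (lamHat : BKT.Site L → ℕ → ℝ),
        (∀ j, BKT.IsTrigPoly (lam j) (lamHat j)) →
      ∃ (F : Finset (Finset (BKT.Site L → ℤ))) (c : Finset (BKT.Site L → ℤ) → ℝ)
        (K : (BKT.Site L → ℤ) → ℝ),
        (∀ E ∈ F, BKT.IsEnsemble E) ∧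
        (∀ E ∈ F, 0 < c E) ∧
        ∑ E ∈ F, c E = 1 ∧
        (∀ ψ : BKT.Site L → ℝ,
          ∏ j, lam j (ψ j) =
            ∑ E ∈ F, c E * ∏ ρ ∈ E, (1 + K ρ * Real.cos (BKT.pairing ψ ρ))) ∧
        ∀ E ∈ F,
          -- (a)
          (∀ ρ₁ ∈ E, ∀ ρ₂ ∈ E, ¬ BKT.Neutral ρ₁ → ¬ BKT.Neutral ρ₂ → ρ₁ = ρ₂) ∧
          -- (b)
          (∀ ρ₁ ∈ E, ∀ ρ₂ ∈ E, ρ₁ ≠ ρ₂ →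
            BKT.M * (min (BKT.diam bc ρ₁ : ℝ) (BKT.diam bc ρ₂ : ℝ)) ^ α
              ≤ (BKT.distance bc ρ₁ ρ₂ : ℝ)) ∧
          (∀ ρc ∈ E, ¬ BKT.Neutral ρc → ∀ ρ ∈ E, ρ ≠ ρc →
            BKT.M * (BKT.diam bc ρ : ℝ) ^ α ≤ (BKT.distance bc ρ ρc : ℝ)) ∧
          -- (c)
          (∀ ρ ∈ E, BKT.Neutral ρ → ∀ ρ₁ ρ₂ : BKT.Site L → ℤ, ρ₁ ≠ 0 → ρ₂ ≠ 0 →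
            Disjoint (BKT.supp ρ₁) (BKT.supp ρ₂) → ρ = ρ₁ + ρ₂ →
            2 * BKT.M * (min (BKT.diam bc ρ₁ : ℝ) (BKT.diam bc ρ₂ : ℝ)) ^ α
              ≤ (BKT.distance bc ρ₁ ρ₂ : ℝ) →
            ¬ BKT.Neutral ρ₁ ∧ ¬ BKT.Neutral ρ₂) ∧
          -- (d)
          (∀ ρ ∈ E, BKT.Neutral ρ →
            |K ρ| ≤ Real.exp (D₂ * (BKT.coverSum bc α ρ : ℝ)) *
              ∏ j ∈ BKT.supp ρ,
                (Real.exp ((ρ j : ℝ) ^ 2) * |lamHat j (ρ j).natAbs|)) :=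
  ⟨100 * Real.log 3, mul_pos (by norm_num) (Real.log_pos (by norm_num)),
    fun _ hα _ bc _ _ _ _ hlam => theorem2p2_general (by linarith) bc hlam⟩
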